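/- **Proposition (Type I error of the double-binned test).** *Setting.* Let $\mathcal X,\mathcal Y$ be measurable spaces and let $\mathcal Z$ be a measurable space equipped with a metric $\delta$. Let $\{B_1,\dots,B_M\}$ be a partition of $\mathcal Z$, and for each $m$ let $\{B_{m,1},\dots,B_{m,b}\}$ be a partition of $B_m$ into measurable sets (the fine bins). Put $$h=\max_{(m,k)\in[M]\times[b]}\ \sup_{z,z'\in B_{m,k}}\delta(z,z')\in[0,\infty].$$ *Test.* Given data $(X_i,Y_i,Z_i)_{i=1}^n$, let $\boldsymbol W_m$ be the tuple of the pairs $(X_i,Y_i)$ with $Z_i\in B_m$, listed in the order of the data, and let $T=f(\boldsymbol W_1,\dots,\boldsymbol W_M)$, where $f$ is any measurable real-valued function. Let $\boldsymbol\Pi_{\rm cyclic}$ be the set of permutations $\pi$ of $\{1,\dots,n\}$ which, for every $(m,k)$, act on the indices $a_0<\dots<a_{\sigma-1}$ of the observations with $Z_i\in B_{m,k}$ by $\pi(a_j)=a_{(j+c)\bmod \sigma}$ for some integer $c=c_{m,k}$. Let $T^{\pi}$ be the statistic computed from $(X_i,Y_{\pi(i)},Z_i)_{i=1}^n$. For $\alpha\in(0,1)$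 the double-binned local permutation test is $$\phi_{{\rm perm},n}=\mathbf 1\{p_{\rm perm}\le\alpha\},\qquad p_{\rm perm}=\frac1{|\boldsymbol\Pi_{\rm cyclic}|}\sum_{\pi\in\boldsymbol\Pi_{\rm cyclic}}\mathbf 1\{T^\pi\ge T\}.$$ *Null classes.* For probability measures $P,Q$ with densities $p,q$ with respect to a common dominating measure $\mu$, let $\mathcal D_{\gamma,\rm H}(P,Q)=\big(\tfrac12\int|p^{1/\gamma}-q^{1/\gamma}|^\gamma d\mu\big)^{1/\gamma}$ for $\gamma\ge1$. For $\gamma>0$ let $\mathcal D_{\gamma,\rm R}(P\|Q)\in[0,\infty]$ be the Rényi divergence, that is, $\frac1{\gamma-1}\log\int p^\gamma q^{1-\gamma}d\mu$ if $\gamma\ne1$ and the Kullback–Leibler divergence if $\gamma=1$ (for $\gamma>1$ the integrand is $\infty$ where $p>0=q$ and $0$ where $p=0$). For $L\ge0$, let $\mathcal P_{0,{\rm H},\gamma,\delta}(L)$ be the set of laws $P_{X,Y,Z}$ on $\mathcal X\times\mathcal Y\times\mathcal Z$ such that $X$ and $Y$ are conditionally independent given $Z$ and, for some versions $P_{X|Z=z}$,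 $P_{Y|Z=z}$ of the regular conditional distributions, $$\mathcal D_{\gamma,\rm H}(P_{X|Z=z},P_{X|Z=z'})\le L\,\delta(z,z'),\qquad \mathcal D_{\gamma,\rm H}(P_{Y|Z=z},P_{Y|Z=z'})\le L\,\delta(z,z')\qquad\text{for all }z,z'\in\mathcal Z.$$ Let $\mathcal P_{0,{\rm R},\gamma,\delta}(L)$ be defined in the same way with $\mathcal D_{\gamma,\rm R}^{1/2}(\cdot\|\cdot)$ in place of $\mathcal D_{\gamma,\rm H}(\cdot,\cdot)$. *Claim.* (i) For every $\gamma\ge1$ there is a finite constant $C_\gamma$ depending only on $\gamma$ such that, for all $\mathcal X,\mathcal Y,\mathcal Z,\delta$, all $M$, $b$, $n$, all bins, all statistics $f$, all $L\ge0$ and all $\alpha\in(0,1)$, $$\sup_{P_{X,Y,Z}\in\mathcal P_{0,{\rm H},\gamma,\delta}(L)}\mathbb E_{P^n_{X,Y,Z}}[\phi_{{\rm perm},n}]\ \le\ \begin{cases}\alpha+C_\gamma n^{1/2}L^\gamma h^\gamma,&\gamma\in[1,2],\\ \alpha+C_\gamma n^{1/2}L^2h^2,&\gamma>2.\end{cases}$$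 (ii) For every $\gamma>0$ there is a finite constant $C_\gamma$ depending only on $\gamma$ such that, in the same generality, $$\sup_{P_{X,Y,Z}\in\mathcal P_{0,{\rm R},\gamma,\delta}(L)}\mathbb E_{P^n_{X,Y,Z}}[\phi_{{\rm perm},n}]\ \le\ \alpha+C_\gamma n^{1/2}L^2h^2.$$ (If $h=\infty$, the bounds are read with $0\cdot\infty=0$.) -/

import Mathlib

open MeasureTheory ProbabilityTheory
open scoped ENNReal NNReal

universe u v w

noncomputable section

namespace DoubleBinTest

/-! ### Generalized Hellinger distance and Rényi divergence -/

/-- Generalized Hellinger distance `(1/2 ∫ |p^(1/γ) - q^(1/γ)|^γ dμ)^(1/γ)` of two finite measures,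
with densities taken with respect to the dominating measure `μ = P + Q`.
(`hellingerDist_eq` shows that any other dominating measure gives the same value.) -/
def hellingerDist {Ω : Type*} [MeasurableSpace Ω] (γ : ℝ) (P Q : Measure Ω) : ℝ≥0∞ :=
  (2⁻¹ * ∫⁻ x, ENNReal.ofReal
    |(P.rnDeriv (P + Q) x).toReal ^ (1 / γ) - (Q.rnDeriv (P + Q) x).toReal ^ (1 / γ)| ^ γ
      ∂(P + Q)) ^ (1 / γ)

/-- Rényi divergence of order `γ` of `P` from `Q`, for probability measures, valued in `[0, ∞]`.
For `γ ≠ 1` it is `(γ - 1)⁻¹ log ∫ p^γ q^(1-γ) dμ` with `μ = P + Q`; the conventions of `ℝ≥0∞`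
make the integrand `0` where `p = 0` (and `γ > 0`), and `∞` where `p > 0 = q` and `γ > 1`
(`renyiIntegral_eq`: another dominating measure gives the same value).
For `γ = 1` it is the Kullback-Leibler divergence. -/
def renyiDiv {Ω : Type*} [MeasurableSpace Ω] (γ : ℝ) (P Q : Measure Ω) : ℝ≥0∞ :=
  if γ = 1 then InformationTheory.klDiv P Q
  else (((γ - 1)⁻¹ : ℝ) * ENNReal.log
    (∫⁻ x, P.rnDeriv (P + Q) x ^ γ * Q.rnDeriv (P + Q) x ^ (1 - γ) ∂(P + Q))).toENNReal

/-- The generalized Hellinger distance does not depend on the dominating measure. -/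
theorem hellingerDist_eq {Ω : Type*} [MeasurableSpace Ω] {γ : ℝ} (hγ : 0 < γ) (P Q μ : Measure Ω)
    [IsFiniteMeasure P] [IsFiniteMeasure Q] [SigmaFinite μ] (hP : P ≪ μ) (hQ : Q ≪ μ) :
    hellingerDist γ P Q = (2⁻¹ * ∫⁻ x, ENNReal.ofReal
      |(P.rnDeriv μ x).toReal ^ (1 / γ) - (Q.rnDeriv μ x).toReal ^ (1 / γ)| ^ γ ∂μ) ^ (1 / γ) := by
  have hν : P + Q ≪ μ := Measure.AbsolutelyContinuous.add_left_iff.2 ⟨hP, hQ⟩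
  have hPν : P ≪ P + Q := Measure.AbsolutelyContinuous.rfl.add_right Q
  have hQν : Q ≪ P + Q := by
    rw [add_comm]; exact Measure.AbsolutelyContinuous.rfl.add_right P
  unfold hellingerDist
  congr 2
  rw [← lintegral_rnDeriv_mul hν (by fun_prop)]
  apply lintegral_congr_ae
  filter_upwards [Measure.rnDeriv_mul_rnDeriv (κ := μ) hPν,
    Measure.rnDeriv_mul_rnDeriv (κ := μ) hQν, (P + Q).rnDeriv_lt_top μ] with x h1 h2 h3
  rw [← h1, ← h2]
  simp only [Pi.mul_apply, ENNReal.toReal_mul]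
  rw [Real.mul_rpow ENNReal.toReal_nonneg ENNReal.toReal_nonneg,
    Real.mul_rpow ENNReal.toReal_nonneg ENNReal.toReal_nonneg, ← sub_mul, abs_mul,
    abs_of_nonneg (Real.rpow_nonneg ENNReal.toReal_nonneg _),
    ENNReal.ofReal_mul (abs_nonneg _), ENNReal.mul_rpow_of_nonneg _ _ hγ.le, mul_comm]
  congr 1
  rw [← ENNReal.ofReal_rpow_of_nonneg ENNReal.toReal_nonneg (by positivity),
    ENNReal.ofReal_toReal h3.ne, ← ENNReal.rpow_mul, one_div, inv_mul_cancel₀ hγ.ne',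
    ENNReal.rpow_one]

/-- The integral in the Rényi divergence does not depend on the dominating measure. -/
theorem renyiIntegral_eq {Ω : Type*} [MeasurableSpace Ω] {γ : ℝ} (hγ : 0 < γ) (P Q μ : Measure Ω)
    [IsFiniteMeasure P] [IsFiniteMeasure Q] [SigmaFinite μ] (hP : P ≪ μ) (hQ : Q ≪ μ) :
    ∫⁻ x, P.rnDeriv (P + Q) x ^ γ * Q.rnDeriv (P + Q) x ^ (1 - γ) ∂(P + Q) =
      ∫⁻ x, P.rnDeriv μ x ^ γ * Q.rnDeriv μ x ^ (1 - γ) ∂μ := by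
  have hν : P + Q ≪ μ := Measure.AbsolutelyContinuous.add_left_iff.2 ⟨hP, hQ⟩
  have hPν : P ≪ P + Q := Measure.AbsolutelyContinuous.rfl.add_right Q
  have hQν : Q ≪ P + Q := by
    rw [add_comm]; exact Measure.AbsolutelyContinuous.rfl.add_right P
  rw [← lintegral_rnDeriv_mul hν (by fun_prop)]
  apply lintegral_congr_ae
  filter_upwards [Measure.rnDeriv_mul_rnDeriv (κ := μ) hPν,
    Measure.rnDeriv_mul_rnDeriv (κ := μ) hQν, (P + Q).rnDeriv_lt_top μ] with x h1 h2 h3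
  rw [← h1, ← h2]
  simp only [Pi.mul_apply]
  rcases eq_or_ne ((P + Q).rnDeriv μ x) 0 with h0 | h0
  · simp [h0, hγ]
  · rw [ENNReal.mul_rpow_eq_ite, ENNReal.mul_rpow_eq_ite]
    simp only [h0, h3.ne, and_false, or_false, false_and, if_false]
    rw [mul_mul_mul_comm, ← ENNReal.rpow_add _ _ h0 h3.ne, add_sub_cancel, ENNReal.rpow_one,
      mul_comm]

/-! ### Null distributions -/

section Classes

variable {X Y Z : Type*} [MeasurableSpace X] [MeasurableSpace Y] [MeasurableSpace Z]

/-- `X` and `Y` are conditionally independent given `Z` under the law `P` of `(X, Y, Z)`, and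
`z ↦ κX z`, `z ↦ κY z` are versions of the conditional laws of `X` and of `Y` given `Z = z`:
the conditional law of `(X, Y)` given `Z = z` is the product `κX z ⊗ κY z`. -/
def IsCondIndepVersion (P : Measure (X × Y × Z)) (κX : Kernel Z X) (κY : Kernel Z Y) : Prop :=
  IsMarkovKernel κX ∧ IsMarkovKernel κY ∧
    P.map (fun w => (w.2.2, (w.1, w.2.1))) = (P.map fun w => w.2.2) ⊗ₘ (κX ×ₖ κY)

/-- Conditionally independent laws with `γ`-Hellinger Lipschitz conditional marginals. -/
def hellingerLipschitz [MetricSpace Z] (γ : ℝ) (L : ℝ≥0) :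
    Set (ProbabilityMeasure (X × Y × Z)) :=
  {P | ∃ (κX : Kernel Z X) (κY : Kernel Z Y), IsCondIndepVersion (P : Measure (X × Y × Z)) κX κY ∧
    ∀ z z' : Z, hellingerDist γ (κX z) (κX z') ≤ L * edist z z' ∧
      hellingerDist γ (κY z) (κY z') ≤ L * edist z z'}

/-- Conditionally independent laws with `γ`-Rényi Lipschitz conditional marginals. -/
def renyiLipschitz [MetricSpace Z] (γ : ℝ) (L : ℝ≥0) :
    Set (ProbabilityMeasure (X × Y × Z)) :=
  {P | ∃ (κX : Kernel Z X) (κY : Kernel Z Y), IsCondIndepVersion (P : Measure (X × Y × Z)) κX κY ∧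
    ∀ z z' : Z, renyiDiv γ (κX z) (κX z') ^ (1 / 2 : ℝ) ≤ L * edist z z' ∧
      renyiDiv γ (κY z) (κY z') ^ (1 / 2 : ℝ) ≤ L * edist z z'}

end Classes

/-! ### Bins -/

/-- A measurable partition of `Z` into `M` coarse bins, each of which is partitioned into `b` fine
bins. Bins may be empty. -/
structure DoubleBinning (Z : Type*) [MeasurableSpace Z] (M b : ℕ) where
  coarse : Fin M → Set Z
  fine : Fin M → Fin b → Set Z
  coarse_disjoint : Pairwise fun m m' => Disjoint (coarse m) (coarse m')
  coarse_cover : ⋃ m, coarse m = Set.univ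
  fine_disjoint : ∀ m, Pairwise fun k k' => Disjoint (fine m k) (fine m k')
  fine_cover : ∀ m, ⋃ k, fine m k = coarse m
  fine_measurable : ∀ m k, MeasurableSet (fine m k)

/-- The maximum diameter of the fine bins. -/
def DoubleBinning.maxDiam {Z : Type*} [MeasurableSpace Z] [MetricSpace Z] {M b : ℕ}
    (B : DoubleBinning Z M b) : ℝ≥0∞ :=
  ⨆ (m : Fin M) (k : Fin b), ⨆ z ∈ B.fine m k, ⨆ z' ∈ B.fine m k, edist z z'

/-! ### The test -/

section Test

variable {X Y Z : Type*} {n : ℕ}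

open Classical in
/-- The indices of the observations with `Z_i ∈ S`. -/
def binIdx (z : Fin n → Z) (S : Set Z) : Finset (Fin n) := {i | z i ∈ S}

/-- The `j`-th index (in increasing order) among those of the observations with `Z_i ∈ S`. -/
def nthIdx (z : Fin n → Z) (S : Set Z) (j : Fin (binIdx z S).card) : Fin n :=
  (binIdx z S).orderEmbOfFin rfl j

/-- The pairs `(X_i, Y_i)` with `Z_i ∈ S`: their number, and the tuple in the order of the data. -/
def binSample (x : Fin n → X) (y : Fin n → Y) (z : Fin n → Z) (S : Set Z) :
    Σ s : ℕ, (Fin s → X × Y) :=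
  ⟨(binIdx z S).card, fun j => (x (nthIdx z S j), y (nthIdx z S j))⟩

variable [MeasurableSpace Z] {M b : ℕ}

/-- The binned statistic `f (W_1, …, W_M)`, computed over the coarse bins. -/
def statistic (B : DoubleBinning Z M b) (f : (Fin M → Σ s : ℕ, (Fin s → X × Y)) → ℝ)
    (x : Fin n → X) (y : Fin n → Y) (z : Fin n → Z) : ℝ :=
  f fun m => binSample x y z (B.coarse m)

open Classical in
/-- The cyclic local permutations: permutations of the indices that act on the observations of
each fine bin, listed as `a_0, …, a_(σ-1)`, by `a_j ↦ a_((j + c) mod σ)` for some `c`. -/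
def cyclicLocalPerms (B : DoubleBinning Z M b) (z : Fin n → Z) : Finset (Equiv.Perm (Fin n)) :=
  {π | ∀ m k, ∃ c : ℕ, ∀ j : Fin (binIdx z (B.fine m k)).card,
    π (nthIdx z (B.fine m k) j) =
      nthIdx z (B.fine m k) ⟨(j + c) % (binIdx z (B.fine m k)).card, Nat.mod_lt _ j.pos⟩}

open Classical in
/-- The permutation p-value: the proportion of cyclic local permutations `π` for which the statistic
of the data with `Y_i` replaced by `Y_(π i)` is at least the observed statistic. -/
def pValue (B : DoubleBinning Z M b) (f : (Fin M → Σ s : ℕ, (Fin s → X × Y)) → ℝ)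
    (x : Fin n → X) (y : Fin n → Y) (z : Fin n → Z) : ℝ :=
  (((cyclicLocalPerms B z).filter fun π =>
      statistic B f x y z ≤ statistic B f x (fun i => y (π i)) z).card : ℝ) /
    (cyclicLocalPerms B z).card

open Classical in
/-- The test function `1(p ≤ α)` on a sample of `n` observations of `(X, Y, Z)`. -/
def permTest (B : DoubleBinning Z M b) (f : (Fin M → Σ s : ℕ, (Fin s → X × Y)) → ℝ) (α : ℝ)
    (w : Fin n → X × Y × Z) : ℝ≥0∞ :=
  if pValue B f (fun i => (w i).1) (fun i => (w i).2.1) (fun i => (w i).2.2) ≤ α then 1 else 0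

end Test

end DoubleBinTest

end

noncomputable section

namespace DoubleBinTest

/-! ### Tensorization of the Hellinger distance -/

/-! The test sees `Z` only through the label of its fine bin, so the law of the data may be replaced
by the `n`-fold power of `Q`, the law of `(X, Y, label)`. Let `R` have the same label law and the
same marginals of `X` and of `Y` given the label, but with `X` and `Y` independent given the label
(`blockLaw`).

Under `R` the test has level `α`. Given the labels and the `X`-values, permuting the `Y`-values
within fine bins does not change their law. The cyclic local permutations preserve labels and are
closed under products, so the usual rank argument for permutation p-values applies
(`lintegral_permTest_blockLaw_le`).

It remains to compare the powers of `Q` and `R`. Suppose that within a fine bin the conditional laws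
of `X`, and those of `Y`, are pairwise within `e` in squared Hellinger distance `∫ (√p - √q)²`. On
each bin `Q` is a mixture of products and `R` is the product of the mixtures. On a cell their
difference is a covariance, half the double integral of `(a z - a z') (b z - b z')`. Cauchy-Schwarz
then bounds the squared Hellinger distance by twice an average of products of an `X`-distance and a
`Y`-distance, hence by `2 e²` (`hellinger_mixture_le`). This gain of a square is the heart of the
matter: Hellinger tensorization gives `2 √(n · 2 e²) ≤ 3 √n e`, linear in `e`.

Finally `e` is controlled by the given divergence: `2 D^γ` for Hellinger with `γ ≤ 2`, a constant
times `D²` for `γ > 2`, and a constant times the Rényi divergence itself.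

The spaces of `X` and `Y` are arbitrary, so a jointly measurable choice of densities is avoided: the
mixtures are compared only after finite discretizations of `X` and `Y`, and general events are
approximated by discretized ones (`pi_le_of_discrete`). -/

theorem sum_prod_le_add_sqrt {W : Type*} [Fintype W] {n : ℕ} {q r : W → ℝ} {d : ℝ}
    (hq : ∀ w, 0 ≤ q w) (hr : ∀ w, 0 ≤ r w) (hq1 : ∑ w, q w = 1) (hr1 : ∑ w, r w = 1)
    (hd : ∑ w, (√(q w) - √(r w)) ^ 2 ≤ d) (E : Finset (Fin n → W)) :
    ∑ w ∈ E, ∏ i, q (w i) ≤ ∑ w ∈ E, ∏ i, r (w i) + 2 * √(n * d) := by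
  classical
  set u : (Fin n → W) → ℝ := fun w => ∏ i, √(q (w i)) with hu
  set v : (Fin n → W) → ℝ := fun w => ∏ i, √(r (w i)) with hv
  have hu2 (w) : ∏ i, q (w i) = u w ^ 2 := by
    simp only [hu, ← Finset.prod_pow, Real.sq_sqrt (hq _)]
  have hv2 (w) : ∏ i, r (w i) = v w ^ 2 := by
    simp only [hv, ← Finset.prod_pow, Real.sq_sqrt (hr _)]
  have su : ∑ w, u w ^ 2 = 1 := by
    simp only [← hu2, ← Fintype.sum_pow, hq1, one_pow]
  have sv : ∑ w, v w ^ 2 = 1 := by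
    simp only [← hv2, ← Fintype.sum_pow, hr1, one_pow]
  set A := ∑ w, √(q w) * √(r w) with hA
  have suv : ∑ w, u w * v w = A ^ n := by
    simp only [hu, hv, ← Finset.prod_mul_distrib]
    rw [hA, Fintype.sum_pow]
  have hA0 : 0 ≤ A := Finset.sum_nonneg fun _ _ => by positivity
  have hA1 : 2 - 2 * A ≤ d := by
    refine le_trans (le_of_eq ?_) hd
    have key (w) : (√(q w) - √(r w)) ^ 2 = q w + r w - 2 * (√(q w) * √(r w)) := by
      rw [sub_sq, Real.sq_sqrt (hq w), Real.sq_sqrt (hr w)]; ring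
    simp only [key, Finset.sum_sub_distrib, Finset.sum_add_distrib, hq1, hr1, ← Finset.mul_sum]
    rw [← hA]; ring
  -- The Hellinger affinity `A` tensorizes to `A ^ n`; Bernoulli's inequality turns this into
  -- subadditivity, `2 - 2 A^n ≤ n (2 - 2 A)`.
  have hAn : 1 + (n : ℝ) * (A - 1) ≤ A ^ n := by
    have := one_add_mul_le_pow (a := A - 1) (by linarith) n
    simpa using this
  have h1 : ∑ w, (u w - v w) ^ 2 ≤ n * d := by
    have key (w) : (u w - v w) ^ 2 = u w ^ 2 + v w ^ 2 - 2 * (u w * v w) := by ring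
    simp only [key, Finset.sum_sub_distrib, Finset.sum_add_distrib, su, sv, ← Finset.mul_sum, suv]
    have : (n : ℝ) * (2 - 2 * A) ≤ n * d := by gcongr
    linarith
  have h2 : ∑ w, (u w + v w) ^ 2 ≤ 4 := by
    calc ∑ w, (u w + v w) ^ 2 ≤ ∑ w, (2 * u w ^ 2 + 2 * v w ^ 2) :=
          Finset.sum_le_sum fun w _ => by nlinarith [sq_nonneg (u w - v w)]
      _ = 4 := by rw [Finset.sum_add_distrib, ← Finset.mul_sum, ← Finset.mul_sum, su, sv]; norm_num
  -- The difference of the two probabilities of `E` is the sum of `u² - v² = (u - v)(u + v)`;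
  -- Cauchy-Schwarz separates the factors.
  have h3 : (∑ w ∈ E, (u w - v w) * (u w + v w)) ^ 2 ≤ n * d * 4 := by
    refine (Finset.sum_mul_sq_le_sq_mul_sq _ _ _).trans ?_
    refine mul_le_mul ?_ ?_ (Finset.sum_nonneg fun _ _ => sq_nonneg _)
      ((Finset.sum_nonneg fun _ _ => sq_nonneg _).trans h1)
    · exact (Finset.sum_le_sum_of_subset_of_nonneg (Finset.subset_univ E)
        fun _ _ _ => sq_nonneg _).trans h1
    · exact (Finset.sum_le_sum_of_subset_of_nonneg (Finset.subset_univ E)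
        fun _ _ _ => sq_nonneg _).trans h2
  have h4 := (le_abs_self _).trans (Real.abs_le_sqrt h3)
  rw [Real.sqrt_mul' _ (by norm_num), show (4 : ℝ) = 2 ^ 2 by norm_num,
    Real.sqrt_sq (by norm_num)] at h4
  have h5 : ∑ w ∈ E, (u w - v w) * (u w + v w) = ∑ w ∈ E, u w ^ 2 - ∑ w ∈ E, v w ^ 2 := by
    rw [← Finset.sum_sub_distrib]; exact Finset.sum_congr rfl fun _ _ => by ring
  simp only [hu2, hv2]
  linarith

/-- The probabilities of an event that depends on a sample only through a finite-valued map. -/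
theorem pi_preimage_eq_sum {Ω W : Type*} [MeasurableSpace Ω] [Fintype W] {n : ℕ}
    (Q : Measure Ω) [IsProbabilityMeasure Q] {g : Ω → W} (hg : ∀ w, MeasurableSet (g ⁻¹' {w}))
    (E : Finset (Fin n → W)) :
    (Measure.pi fun _ : Fin n => Q).real ((fun x i => g (x i)) ⁻¹' ↑E) =
      ∑ w ∈ E, ∏ i, Q.real (g ⁻¹' {w i}) := by
  have h (w : Fin n → W) : (fun (x : Fin n → Ω) i => g (x i)) ⁻¹' {w} =
      Set.univ.pi fun i => g ⁻¹' {w i} := by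
    ext x; simp [funext_iff]
  rw [measureReal_def, ← sum_measure_preimage_singleton, ENNReal.toReal_sum]
  · refine Finset.sum_congr rfl fun w _ => ?_
    rw [h, Measure.pi_pi, ENNReal.toReal_prod]; rfl
  · exact fun _ _ => measure_ne_top _ _
  · intro w _
    rw [h]; exact MeasurableSet.univ_pi fun i => hg _

theorem sum_preimage_eq_one {Ω W : Type*} [MeasurableSpace Ω] [Fintype W]
    (Q : Measure Ω) [IsProbabilityMeasure Q] {g : Ω → W} (hg : ∀ w, MeasurableSet (g ⁻¹' {w})) :
    ∑ w, Q.real (g ⁻¹' {w}) = 1 := by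
  simp only [measureReal_def]
  rw [← ENNReal.toReal_sum fun _ _ => measure_ne_top _ _, sum_measure_preimage_singleton]
  · simp
  · exact fun w _ => hg w

theorem pi_preimage_le {Ω W : Type*} [MeasurableSpace Ω] [Fintype W] {n : ℕ}
    (Q R : Measure Ω) [IsProbabilityMeasure Q] [IsProbabilityMeasure R] {g : Ω → W} {d : ℝ}
    (hg : ∀ w, MeasurableSet (g ⁻¹' {w}))
    (hd : ∑ w, (√(Q.real (g ⁻¹' {w})) - √(R.real (g ⁻¹' {w}))) ^ 2 ≤ d) (E : Set (Fin n → W)) :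
    (Measure.pi fun _ : Fin n => Q).real ((fun x i => g (x i)) ⁻¹' E) ≤
      (Measure.pi fun _ : Fin n => R).real ((fun x i => g (x i)) ⁻¹' E) + 2 * √(n * d) := by
  classical
  have hE : E = ↑E.toFinite.toFinset := by simp
  rw [hE, pi_preimage_eq_sum Q hg, pi_preimage_eq_sum R hg]
  exact sum_prod_le_add_sqrt (fun _ => measureReal_nonneg) (fun _ => measureReal_nonneg)
    (sum_preimage_eq_one Q hg) (sum_preimage_eq_one R hg) hd _

/-! ### From discretized events to arbitrary events of a sample. -/

section Algebra

variable {X : Type u} {Y : Type v} {J : Type w} [MeasurableSpace X] [MeasurableSpace Y]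
  [MeasurableSpace J]

/-- The events on a sample that depend only on a discretization of the first two components. -/
def discreteEvents (X : Type u) (Y : Type v) (J : Type w) [MeasurableSpace X] [MeasurableSpace Y]
    (n : ℕ) : Set (Set (Fin n → X × Y × J)) :=
  {E | ∃ (A B : Type) (_ : Fintype A) (_ : Fintype B) (s : X → A) (t : Y → B)
    (E' : Set (Fin n → A × B × J)), (∀ a, MeasurableSet (s ⁻¹' {a})) ∧
    (∀ b, MeasurableSet (t ⁻¹' {b})) ∧ E = (fun w i => (s (w i).1, t (w i).2.1, (w i).2.2)) ⁻¹' E'}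

-- Two discretizations have a common refinement, obtained by pairing them, which handles unions.
omit [MeasurableSpace J] in
theorem isSetAlgebra_discreteEvents (n : ℕ) : IsSetAlgebra (discreteEvents X Y J n) where
  empty_mem := ⟨Unit, Unit, inferInstance, inferInstance, fun _ => (), fun _ => (), ∅,
    by simp, by simp, by simp⟩
  compl_mem := by
    rintro _ ⟨A, B, iA, iB, s, t, E, hs, ht, rfl⟩
    exact ⟨A, B, iA, iB, s, t, Eᶜ, hs, ht, rfl⟩
  union_mem := by
    rintro _ _ ⟨A, B, iA, iB, s, t, E, hs, ht, rfl⟩ ⟨A', B', iA', iB', s', t', E', hs', ht', rfl⟩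
    refine ⟨A × A', B × B', inferInstance, inferInstance, fun x => (s x, s' x),
      fun y => (t y, t' y), {w | (fun i => ((w i).1.1, (w i).2.1.1, (w i).2.2)) ∈ E ∨
        (fun i => ((w i).1.2, (w i).2.1.2, (w i).2.2)) ∈ E'}, ?_, ?_, rfl⟩
    · rintro ⟨a, a'⟩
      convert (hs a).inter (hs' a') using 1
      ext; simp
    · rintro ⟨a, a'⟩
      convert (ht a).inter (ht' a') using 1
      ext; simp

theorem measurableSet_preimage_discrete [Fintype J] [MeasurableSingletonClass J] {A B : Type}
    {s : X → A} {t : Y → B} (hs : ∀ a, MeasurableSet (s ⁻¹' {a}))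
    (ht : ∀ b, MeasurableSet (t ⁻¹' {b})) (c : A × B × J) :
    MeasurableSet ((fun w : X × Y × J => (s w.1, t w.2.1, w.2.2)) ⁻¹' {c}) := by
  convert (hs c.1).prod ((ht c.2.1).prod (measurableSet_singleton c.2.2)) using 1
  ext; simp [Prod.ext_iff]

theorem generateFrom_discreteEvents [Fintype J] [MeasurableSingletonClass J] (n : ℕ) :
    (inferInstance : MeasurableSpace (Fin n → X × Y × J)) =
      MeasurableSpace.generateFrom (discreteEvents X Y J n) := by
  apply le_antisymm
  · have h : @Measurable _ _ (MeasurableSpace.generateFrom (discreteEvents X Y J n)) _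
        (id : (Fin n → X × Y × J) → (Fin n → X × Y × J)) := by
      let _ : MeasurableSpace (Fin n → X × Y × J) :=
        MeasurableSpace.generateFrom (discreteEvents X Y J n)
      refine measurable_pi_iff.2 fun i => Measurable.prodMk ?_ (Measurable.prodMk ?_ ?_)
      · intro S hS
        -- `Prop` serves as the two-point space: the discretization is the indicator of `S`.
        refine MeasurableSpace.measurableSet_generateFrom
          ⟨Prop, Unit, inferInstance, inferInstance, fun x => x ∈ S, fun _ => (),
            {w | (w i).1}, ?_, by simp, rfl⟩
        intro a
        exact (measurable_mem.2 hS) (measurableSet_singleton a)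
      · intro S hS
        refine MeasurableSpace.measurableSet_generateFrom
          ⟨Unit, Prop, inferInstance, inferInstance, fun _ => (), fun x => x ∈ S,
            {w | (w i).2.1}, by simp, ?_, rfl⟩
        intro a
        exact (measurable_mem.2 hS) (measurableSet_singleton a)
      · intro S hS
        exact MeasurableSpace.measurableSet_generateFrom
          ⟨Unit, Unit, inferInstance, inferInstance, fun _ => (), fun _ => (),
            {w | (w i).2.2 ∈ S}, by simp, by simp, rfl⟩
    intro S hS
    exact h hS
  · refine MeasurableSpace.generateFrom_le ?_
    rintro _ ⟨A, B, iA, iB, s, t, E, hs, ht, rfl⟩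
    have hE : E = ⋃ w ∈ E.toFinite.toFinset, {w} := by simp
    rw [hE]
    simp only [Set.preimage_iUnion]
    refine Finset.measurableSet_biUnion _ fun c _ => ?_
    have : (fun (w : Fin n → X × Y × J) i => (s (w i).1, t (w i).2.1, (w i).2.2)) ⁻¹' {c} =
        Set.univ.pi fun i => (fun w : X × Y × J => (s w.1, t w.2.1, w.2.2)) ⁻¹' {c i} := by
      ext; simp [funext_iff]
    rw [this]
    exact MeasurableSet.univ_pi fun i => measurableSet_preimage_discrete hs ht _

/-- A Hellinger bound for all discretizations of the components bounds the difference of the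
probabilities of any event of a sample. -/
theorem pi_le_of_discrete [Fintype J] [MeasurableSingletonClass J] {n : ℕ}
    (Q R : Measure (X × Y × J)) [IsProbabilityMeasure Q] [IsProbabilityMeasure R] {d : ℝ}
    (hd : ∀ (A B : Type) [Fintype A] [Fintype B] (s : X → A) (t : Y → B),
      (∀ a, MeasurableSet (s ⁻¹' {a})) → (∀ b, MeasurableSet (t ⁻¹' {b})) →
      ∑ c : A × B × J, (√(Q.real ((fun w => (s w.1, t w.2.1, w.2.2)) ⁻¹' {c})) -
        √(R.real ((fun w => (s w.1, t w.2.1, w.2.2)) ⁻¹' {c}))) ^ 2 ≤ d)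
    {E : Set (Fin n → X × Y × J)} (hE : MeasurableSet E) :
    (Measure.pi fun _ : Fin n => Q).real E ≤
      (Measure.pi fun _ : Fin n => R).real E + 2 * √(n * d) := by
  set μ := Measure.pi fun _ : Fin n => Q
  set ν := Measure.pi fun _ : Fin n => R
  have hden := Measure.MeasureDense.of_generateFrom_isSetAlgebra_finite (μ + ν)
    (isSetAlgebra_discreteEvents n) (generateFrom_discreteEvents (X := X) (Y := Y) (J := J) n)
  refine le_of_forall_pos_le_add fun δ hδ => ?_
  -- Approximating with respect to the sum `μ + ν` controls the error under both laws with a single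
  -- `T`.
  obtain ⟨T, hT, hTE⟩ := hden.approx E hE (measure_ne_top _ _) (δ / 2) (by positivity)
  have hδ' : μ.real (symmDiff E T) + ν.real (symmDiff E T) < δ / 2 := by
    rw [Measure.add_apply, ENNReal.lt_ofReal_iff_toReal_lt (by finiteness),
      ENNReal.toReal_add (by finiteness) (by finiteness)] at hTE
    exact hTE
  have h1 : μ.real T ≤ ν.real T + 2 * √(n * d) := by
    obtain ⟨A, B, iA, iB, s, t, E', hs, ht, rfl⟩ := hT
    exact pi_preimage_le Q R (g := fun w => (s w.1, t w.2.1, w.2.2))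
      (measurableSet_preimage_discrete hs ht) (hd A B s t hs ht) E'
  have h2 : μ.real E ≤ μ.real T + μ.real (symmDiff E T) := by
    refine (measureReal_mono ?_).trans (measureReal_union_le _ _)
    intro x hx
    by_cases hxT : x ∈ T
    · exact Or.inl hxT
    · exact Or.inr (Or.inl ⟨hx, hxT⟩)
  have h3 : ν.real T ≤ ν.real E + ν.real (symmDiff E T) := by
    refine (measureReal_mono ?_).trans (measureReal_union_le _ _)
    intro x hx
    by_cases hxE : x ∈ E
    · exact Or.inl hxE
    · exact Or.inr (Or.inr ⟨hx, hxE⟩)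
  have h4 : 0 ≤ μ.real (symmDiff E T) := measureReal_nonneg
  have h5 : 0 ≤ ν.real (symmDiff E T) := measureReal_nonneg
  linarith

end Algebra

/-! ### Mixtures of product distributions against products of mixtures -/

/-- Cauchy-Schwarz, from the discriminant of the nonnegative quadratic `t ↦ ∫ (f t + g)²`. -/
theorem sq_integral_mul_le {Ω : Type*} [MeasurableSpace Ω] {ν : Measure Ω} {f g : Ω → ℝ}
    (hf : Integrable (fun x => f x ^ 2) ν) (hg : Integrable (fun x => g x ^ 2) ν)
    (hfg : Integrable (fun x => f x * g x) ν) :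
    (∫ x, f x * g x ∂ν) ^ 2 ≤ (∫ x, f x ^ 2 ∂ν) * ∫ x, g x ^ 2 ∂ν := by
  have h := discrim_le_zero (a := ∫ x, f x ^ 2 ∂ν) (b := 2 * ∫ x, f x * g x ∂ν)
    (c := ∫ x, g x ^ 2 ∂ν) fun t => by
      have h0 : 0 ≤ ∫ x, (f x * t + g x) ^ 2 ∂ν := integral_nonneg fun _ => sq_nonneg _
      have h1 : ∫ x, (f x * t + g x) ^ 2 ∂ν = ∫ x, ((t * t) * f x ^ 2 + (2 * t) * (f x * g x)
          + g x ^ 2) ∂ν := integral_congr_ae (.of_forall fun x => by ring)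
      have h2 : Integrable (fun x => (t * t) * f x ^ 2 + (2 * t) * (f x * g x)) ν :=
        (hf.const_mul _).add (hfg.const_mul _)
      rw [h1, integral_add h2 hg, integral_add (hf.const_mul _) (hfg.const_mul _), integral_const_mul,
        integral_const_mul] at h0
      linarith
  rw [discrim] at h
  nlinarith

theorem sqrt_sub_sqrt_sq_mul_add_le {x y : ℝ} (hx : 0 ≤ x) (hy : 0 ≤ y) :
    (√x - √y) ^ 2 * (x + y) ≤ (x - y) ^ 2 := by
  have h1 := Real.sq_sqrt hx
  have h2 := Real.sq_sqrt hy
  have h3 : (x - y) ^ 2 = (√x - √y) ^ 2 * (√x + √y) ^ 2 := by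
    rw [← mul_pow, mul_comm, ← sq_sub_sq, h1, h2]
  rw [h3]
  gcongr
  nlinarith [mul_nonneg (Real.sqrt_nonneg x) (Real.sqrt_nonneg y)]

variable {Z : Type*} [MeasurableSpace Z]

theorem integrable_of_mem_Icc {Ω : Type*} [MeasurableSpace Ω] {ν : Measure Ω} [IsFiniteMeasure ν]
    {f : Ω → ℝ} (hf : Measurable f) {c : ℝ} (h : ∀ x, |f x| ≤ c) : Integrable f ν :=
  Integrable.of_bound hf.aestronglyMeasurable c (.of_forall h)

/-- The pointwise form of the bound for a mixture: `q = ∫ a b`, `r = ∫ a ∫ b`. -/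
theorem hellinger_mixture_cell_le (lam : Measure Z) [IsProbabilityMeasure lam] {a b : Z → ℝ}
    (ha : Measurable a) (hb : Measurable b) (ha0 : ∀ z, 0 ≤ a z) (hb0 : ∀ z, 0 ≤ b z)
    (ha1 : ∀ z, a z ≤ 1) (hb1 : ∀ z, b z ≤ 1) :
    (√(∫ z, a z * b z ∂lam) - √((∫ z, a z ∂lam) * ∫ z, b z ∂lam)) ^ 2 ≤
      2 * ∫ p, (√(a p.1) - √(a p.2)) ^ 2 * (√(b p.1) - √(b p.2)) ^ 2 ∂(lam.prod lam) := by
  set q := ∫ z, a z * b z ∂lam with hq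
  set r := (∫ z, a z ∂lam) * ∫ z, b z ∂lam with hr
  set G := ∫ p, (√(a p.1) - √(a p.2)) ^ 2 * (√(b p.1) - √(b p.2)) ^ 2 ∂(lam.prod lam) with hG
  have hG0 : 0 ≤ G := integral_nonneg fun _ => by positivity
  have hq0 : 0 ≤ q := integral_nonneg fun z => mul_nonneg (ha0 z) (hb0 z)
  have hr0 : 0 ≤ r := mul_nonneg (integral_nonneg ha0) (integral_nonneg hb0)
  have sa0 (z) : 0 ≤ √(a z) := Real.sqrt_nonneg _
  have sb0 (z) : 0 ≤ √(b z) := Real.sqrt_nonneg _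
  have sa1 (z) : √(a z) ≤ 1 := Real.sqrt_le_one.2 (ha1 z)
  have sb1 (z) : √(b z) ≤ 1 := Real.sqrt_le_one.2 (hb1 z)
  have hprod (f g : Z → ℝ) (hf : Measurable f) (hg : Measurable g) (hf0 : ∀ z, 0 ≤ f z)
      (hg0 : ∀ z, 0 ≤ g z) (hf1 : ∀ z, f z ≤ 1) (hg1 : ∀ z, g z ≤ 1) :
      Integrable (fun p : Z × Z => f p.1 * g p.2) (lam.prod lam) := by
    refine integrable_of_mem_Icc (by fun_prop) (c := 1) fun p => ?_
    rw [abs_of_nonneg (mul_nonneg (hf0 _) (hg0 _))]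
    exact mul_le_one₀ (hf1 _) (hg0 _) (hg1 _)
  have hab0 (z) : 0 ≤ a z * b z := mul_nonneg (ha0 z) (hb0 z)
  have hab1 (z) : a z * b z ≤ 1 := mul_le_one₀ (ha1 z) (hb0 z) (hb1 z)
  have i1 : Integrable (fun p : Z × Z => (a p.1 * b p.1) * 1) (lam.prod lam) :=
    hprod _ (fun _ => 1) (ha.mul hb) measurable_const hab0 (by simp) hab1 (by simp)
  have i2 : Integrable (fun p : Z × Z => 1 * (a p.2 * b p.2)) (lam.prod lam) :=
    hprod (fun _ => 1) _ measurable_const (ha.mul hb) (by simp) hab0 (by simp) hab1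
  have i3 : Integrable (fun p : Z × Z => a p.1 * b p.2) (lam.prod lam) :=
    hprod _ _ ha hb ha0 hb0 ha1 hb1
  have i4 : Integrable (fun p : Z × Z => b p.1 * a p.2) (lam.prod lam) :=
    hprod _ _ hb ha hb0 ha0 hb1 ha1
  have e1 : ∫ p, (a p.1 * b p.1) * 1 ∂(lam.prod lam) = q := by
    rw [integral_prod_mul (fun z => a z * b z) (fun _ => (1 : ℝ))]; simp [hq]
  have e2 : ∫ p, 1 * (a p.2 * b p.2) ∂(lam.prod lam) = q := by
    rw [integral_prod_mul (fun _ => (1 : ℝ)) (fun z => a z * b z)]; simp [hq]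
  have e3 : ∫ p, a p.1 * b p.2 ∂(lam.prod lam) = r := integral_prod_mul _ _
  have e4 : ∫ p, b p.1 * a p.2 ∂(lam.prod lam) = r := by
    rw [integral_prod_mul b a, hr, mul_comm]
  have i12 : Integrable (fun p : Z × Z => (a p.1 * b p.1) * 1 + 1 * (a p.2 * b p.2))
    (lam.prod lam) := i1.add i2
  have i34 : Integrable (fun p : Z × Z => a p.1 * b p.2 + b p.1 * a p.2) (lam.prod lam) :=
    i3.add i4
  -- `q - r` is a covariance, symmetrized over two independent copies of `z`.
  have hcov : ∫ p, (a p.1 - a p.2) * (b p.1 - b p.2) ∂(lam.prod lam) = 2 * (q - r) := by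
    have : ∫ p, (a p.1 - a p.2) * (b p.1 - b p.2) ∂(lam.prod lam) =
        ∫ p, ((a p.1 * b p.1) * 1 + 1 * (a p.2 * b p.2) - (a p.1 * b p.2 + b p.1 * a p.2))
          ∂(lam.prod lam) := integral_congr_ae (.of_forall fun p => by ring)
    rw [this, integral_sub i12 i34, integral_add i1 i2, integral_add i3 i4,
      e1, e2, e3, e4]
    ring
  have hsum : ∫ p, (a p.1 + a p.2) * (b p.1 + b p.2) ∂(lam.prod lam) = 2 * (q + r) := by
    have : ∫ p, (a p.1 + a p.2) * (b p.1 + b p.2) ∂(lam.prod lam) =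
        ∫ p, ((a p.1 * b p.1) * 1 + 1 * (a p.2 * b p.2) + (a p.1 * b p.2 + b p.1 * a p.2))
          ∂(lam.prod lam) := integral_congr_ae (.of_forall fun p => by ring)
    rw [this, integral_add i12 i34, integral_add i1 i2, integral_add i3 i4,
      e1, e2, e3, e4]
    ring
  -- Each difference `a - a'` splits as `(√a - √a')(√a + √a')`. In Cauchy-Schwarz, `F` carries the
  -- Hellinger terms and `∫ K² ≤ 8 (q + r)`; the factor `q + r` is cancelled at the end.
  set F : Z × Z → ℝ := fun p => (√(a p.1) - √(a p.2)) * (√(b p.1) - √(b p.2)) with hF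
  set K : Z × Z → ℝ := fun p => (√(a p.1) + √(a p.2)) * (√(b p.1) + √(b p.2)) with hK
  have mF : Measurable F := by fun_prop
  have mK : Measurable K := by fun_prop
  have bF (p) : |F p| ≤ 1 := by
    rw [hF, abs_mul]
    refine mul_le_one₀ ?_ (abs_nonneg _) ?_ <;> rw [abs_le] <;> constructor
    · linarith [sa0 p.1, sa1 p.2]
    · linarith [sa0 p.2, sa1 p.1]
    · linarith [sb0 p.1, sb1 p.2]
    · linarith [sb0 p.2, sb1 p.1]
  have K0 (p) : 0 ≤ K p := mul_nonneg (add_nonneg (sa0 _) (sa0 _)) (add_nonneg (sb0 _) (sb0 _))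
  have bK (p) : |K p| ≤ 4 := by
    rw [abs_of_nonneg (K0 p)]
    calc K p ≤ 2 * 2 := by
          refine mul_le_mul ?_ ?_ (add_nonneg (sb0 _) (sb0 _)) (by norm_num)
          · linarith [sa1 p.1, sa1 p.2]
          · linarith [sb1 p.1, sb1 p.2]
      _ = 4 := by norm_num
  have iF : Integrable (fun p => F p ^ 2) (lam.prod lam) :=
    integrable_of_mem_Icc (by fun_prop) (c := 1 ^ 2) fun p => by
      rw [abs_pow]; exact pow_le_pow_left₀ (abs_nonneg _) (bF p) 2
  have iK : Integrable (fun p => K p ^ 2) (lam.prod lam) :=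
    integrable_of_mem_Icc (by fun_prop) (c := 4 ^ 2) fun p => by
      rw [abs_pow]; exact pow_le_pow_left₀ (abs_nonneg _) (bK p) 2
  have iFK : Integrable (fun p => F p * K p) (lam.prod lam) :=
    integrable_of_mem_Icc (by fun_prop) (c := 1 * 4) fun p => by
      rw [abs_mul]; exact mul_le_mul (bF p) (bK p) (abs_nonneg _) (by norm_num)
  have hCS := sq_integral_mul_le iF iK iFK
  have hFK : ∫ p, F p * K p ∂(lam.prod lam) = 2 * (q - r) := by
    rw [← hcov]
    refine integral_congr_ae (.of_forall fun p => ?_)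
    have h1 := Real.sq_sqrt (ha0 p.1)
    have h2 := Real.sq_sqrt (ha0 p.2)
    have h3 := Real.sq_sqrt (hb0 p.1)
    have h4 := Real.sq_sqrt (hb0 p.2)
    simp only [hF, hK]
    rw [← h1, ← h2, ← h3, ← h4]
    simp only [Real.sqrt_sq (Real.sqrt_nonneg _)]
    ring
  have hFF : ∫ p, F p ^ 2 ∂(lam.prod lam) = G :=
    integral_congr_ae (.of_forall fun p => by simp only [hF, mul_pow])
  have hKK : ∫ p, K p ^ 2 ∂(lam.prod lam) ≤ 4 * (2 * (q + r)) := by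
    rw [← hsum, ← integral_const_mul]
    refine integral_mono iK ?_ fun p => ?_
    · exact integrable_of_mem_Icc (by fun_prop) (c := 4 * (2 * 2)) fun p => by
        rw [abs_of_nonneg (by
          have := ha0 p.1; have := ha0 p.2; have := hb0 p.1; have := hb0 p.2; positivity)]
        have := ha1 p.1; have := ha1 p.2; have := hb1 p.1; have := hb1 p.2
        have := ha0 p.1; have := ha0 p.2; have := hb0 p.1; have := hb0 p.2
        gcongr <;> linarith
    · simp only [hK, mul_pow]
      have h1 : (√(a p.1) + √(a p.2)) ^ 2 ≤ 2 * (a p.1 + a p.2) := by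
        nlinarith [Real.sq_sqrt (ha0 p.1), Real.sq_sqrt (ha0 p.2), sq_nonneg (√(a p.1) - √(a p.2))]
      have h2 : (√(b p.1) + √(b p.2)) ^ 2 ≤ 2 * (b p.1 + b p.2) := by
        nlinarith [Real.sq_sqrt (hb0 p.1), Real.sq_sqrt (hb0 p.2), sq_nonneg (√(b p.1) - √(b p.2))]
      calc _ ≤ (2 * (a p.1 + a p.2)) * (2 * (b p.1 + b p.2)) :=
            mul_le_mul h1 h2 (sq_nonneg _) (by have := ha0 p.1; have := ha0 p.2; positivity)
        _ = _ := by ring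
  rw [hFK, hFF] at hCS
  have h1 : (2 * (q - r)) ^ 2 ≤ G * (4 * (2 * (q + r))) :=
    hCS.trans (mul_le_mul_of_nonneg_left hKK hG0)
  have h2 := sqrt_sub_sqrt_sq_mul_add_le hq0 hr0
  rcases (add_nonneg hq0 hr0).eq_or_lt with h0 | h0
  · have hq' : q = 0 := by linarith
    have hr' : r = 0 := by linarith
    simp [hq', hr', hG0]
  · refine le_of_mul_le_mul_right ?_ h0
    nlinarith

/-- A mixture of product distributions is close in Hellinger distance to the product of the
mixtures. -/
theorem hellinger_mixture_le {A B : Type*} [Fintype A] [Fintype B] (lam : Measure Z)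
    [IsProbabilityMeasure lam] {a : A → Z → ℝ} {b : B → Z → ℝ} {S : Set Z} {e : ℝ}
    (ha : ∀ i, Measurable (a i)) (hb : ∀ i, Measurable (b i)) (ha0 : ∀ i z, 0 ≤ a i z)
    (hb0 : ∀ i z, 0 ≤ b i z) (ha1 : ∀ i z, a i z ≤ 1) (hb1 : ∀ i z, b i z ≤ 1)
    (hS : ∀ᵐ z ∂lam, z ∈ S)
    (hae : ∀ z ∈ S, ∀ z' ∈ S, ∑ i, (√(a i z) - √(a i z')) ^ 2 ≤ e)
    (hbe : ∀ z ∈ S, ∀ z' ∈ S, ∑ i, (√(b i z) - √(b i z')) ^ 2 ≤ e) :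
    ∑ i, ∑ j, (√(∫ z, a i z * b j z ∂lam) - √((∫ z, a i z ∂lam) * ∫ z, b j z ∂lam)) ^ 2 ≤
      2 * e ^ 2 := by
  calc _ ≤ ∑ i, ∑ j, 2 * ∫ p, (√(a i p.1) - √(a i p.2)) ^ 2 * (√(b j p.1) - √(b j p.2)) ^ 2
          ∂(lam.prod lam) :=
        Finset.sum_le_sum fun i _ => Finset.sum_le_sum fun j _ =>
          hellinger_mixture_cell_le lam (ha i) (hb j) (ha0 i) (hb0 j) (ha1 i) (hb1 j)
    _ = 2 * ∫ p, (∑ i, (√(a i p.1) - √(a i p.2)) ^ 2) * (∑ j, (√(b j p.1) - √(b j p.2)) ^ 2)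
          ∂(lam.prod lam) := by
        simp only [← Finset.mul_sum]
        congr 1
        simp only [Finset.sum_mul_sum]
        have hint (i j) : Integrable (fun p : Z × Z =>
            (√(a i p.1) - √(a i p.2)) ^ 2 * (√(b j p.1) - √(b j p.2)) ^ 2) (lam.prod lam) := by
          have := ha i; have := hb j
          refine integrable_of_mem_Icc (by fun_prop) (c := 1 ^ 2 * 1 ^ 2) fun p => ?_
          rw [abs_mul, abs_pow, abs_pow]
          have sa0 (z) : 0 ≤ √(a i z) := Real.sqrt_nonneg _
          have sb0 (z) : 0 ≤ √(b j z) := Real.sqrt_nonneg _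
          have sa1 (z) : √(a i z) ≤ 1 := Real.sqrt_le_one.2 (ha1 i z)
          have sb1 (z) : √(b j z) ≤ 1 := Real.sqrt_le_one.2 (hb1 j z)
          gcongr <;> rw [abs_le] <;> constructor
          · linarith [sa0 p.1, sa1 p.2]
          · linarith [sa0 p.2, sa1 p.1]
          · linarith [sb0 p.1, sb1 p.2]
          · linarith [sb0 p.2, sb1 p.1]
        rw [integral_finsetSum _ fun i _ => integrable_finsetSum _ fun j _ => hint i j]
        exact Finset.sum_congr rfl fun i _ => (integral_finsetSum _ fun j _ => hint i j).symm
    -- Almost every pair has both points in `S`, so each of the two factors is at most `e`.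
    _ ≤ 2 * ∫ _, e ^ 2 ∂(lam.prod lam) := by
        refine mul_le_mul_of_nonneg_left ?_ (by norm_num)
        refine integral_mono_of_nonneg (.of_forall fun p => ?_) (integrable_const _) ?_
        · exact mul_nonneg (Finset.sum_nonneg fun _ _ => sq_nonneg _)
            (Finset.sum_nonneg fun _ _ => sq_nonneg _)
        · filter_upwards [Measure.quasiMeasurePreserving_fst.ae hS,
            Measure.quasiMeasurePreserving_snd.ae hS] with p h1 h2
          rw [sq]
          exact mul_le_mul (hae _ h1 _ h2) (hbe _ h1 _ h2)
            (Finset.sum_nonneg fun _ _ => sq_nonneg _)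
            ((Finset.sum_nonneg fun _ _ => sq_nonneg _).trans (hae _ h1 _ h2))
    _ = 2 * e ^ 2 := by simp

/-! ### The squared Hellinger distance, data processing and comparison of divergences -/

/-- The (unnormalized) squared Hellinger distance `∫ (√p - √q)² dμ`, with densities taken with
respect to `μ`. -/
def hellingerSq {Ω : Type*} [MeasurableSpace Ω] (P Q μ : Measure Ω) : ℝ≥0∞ :=
  ∫⁻ x, ENNReal.ofReal ((√(P.rnDeriv μ x).toReal - √(Q.rnDeriv μ x).toReal) ^ 2) ∂μ

section DataProcessing

variable {Ω : Type*} [MeasurableSpace Ω] {P Q μ : Measure Ω}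

theorem lintegral_ofReal_sqrt_rnDeriv [IsFiniteMeasure P] [SigmaFinite μ] (hP : P ≪ μ)
    (S : Set Ω) :
    ∫⁻ x in S, ENNReal.ofReal (√(P.rnDeriv μ x).toReal) ^ (2 : ℝ) ∂μ = P S := by
  rw [← Measure.setLIntegral_rnDeriv hP]
  refine lintegral_congr_ae (ae_restrict_of_ae ?_)
  filter_upwards [P.rnDeriv_lt_top μ] with x hx
  rw [ENNReal.ofReal_rpow_of_nonneg (Real.sqrt_nonneg _) (by norm_num), Real.rpow_two,
    Real.sq_sqrt ENNReal.toReal_nonneg, ENNReal.ofReal_toReal hx.ne]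

/-- Minkowski's inequality in `L²` of `μ` restricted to `S`: the root of `P S` is the norm of `√p`.
-/
theorem sqrt_real_le_add [IsFiniteMeasure P] [IsFiniteMeasure Q] [SigmaFinite μ]
    (hP : P ≪ μ) (hQ : Q ≪ μ) (S : Set Ω) :
    P S ^ (1 / 2 : ℝ) ≤ Q S ^ (1 / 2 : ℝ) + (∫⁻ x in S, ENNReal.ofReal
      ((√(P.rnDeriv μ x).toReal - √(Q.rnDeriv μ x).toReal) ^ 2) ∂μ) ^ (1 / 2 : ℝ) := by
  have h := ENNReal.lintegral_Lp_add_le (μ := μ.restrict S) (p := 2)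
    (f := fun x => ENNReal.ofReal √(Q.rnDeriv μ x).toReal)
    (g := fun x => ENNReal.ofReal |√(P.rnDeriv μ x).toReal - √(Q.rnDeriv μ x).toReal|)
    (by fun_prop) (by fun_prop) (by norm_num)
  rw [lintegral_ofReal_sqrt_rnDeriv hQ] at h
  have e (x : Ω) : ENNReal.ofReal |√(P.rnDeriv μ x).toReal - √(Q.rnDeriv μ x).toReal| ^ (2 : ℝ) =
      ENNReal.ofReal ((√(P.rnDeriv μ x).toReal - √(Q.rnDeriv μ x).toReal) ^ 2) := by
    rw [ENNReal.ofReal_rpow_of_nonneg (abs_nonneg _) (by norm_num), Real.rpow_two, sq_abs]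
  simp only [e] at h
  refine le_trans ?_ h
  rw [← lintegral_ofReal_sqrt_rnDeriv hP]
  gcongr with x
  simp only [Pi.add_apply]
  rw [← ENNReal.ofReal_add (Real.sqrt_nonneg _) (abs_nonneg _)]
  refine ENNReal.ofReal_le_ofReal ?_
  linarith [le_abs_self (√(P.rnDeriv μ x).toReal - √(Q.rnDeriv μ x).toReal)]

/-- The reverse triangle inequality for these `L²` norms; summed over the cells of a partition it
gives data processing. -/
theorem ofReal_sqrt_sub_sq_le [IsFiniteMeasure P] [IsFiniteMeasure Q] [SigmaFinite μ]
    (hP : P ≪ μ) (hQ : Q ≪ μ) (S : Set Ω) :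
    ENNReal.ofReal ((√(P.real S) - √(Q.real S)) ^ 2) ≤ ∫⁻ x in S, ENNReal.ofReal
      ((√(P.rnDeriv μ x).toReal - √(Q.rnDeriv μ x).toReal) ^ 2) ∂μ := by
  set I := ∫⁻ x in S, ENNReal.ofReal
      ((√(P.rnDeriv μ x).toReal - √(Q.rnDeriv μ x).toReal) ^ 2) ∂μ with hI
  have h1 := sqrt_real_le_add hP hQ S
  have h2 := sqrt_real_le_add hQ hP S
  simp only [← sub_sq_comm (√(P.rnDeriv μ _).toReal)] at h2
  rw [← hI] at h1 h2
  rcases eq_or_ne I ⊤ with h | h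
  · simp [h]
  have hp : ENNReal.ofReal √(P.real S) = P S ^ (1 / 2 : ℝ) := by
    rw [Real.sqrt_eq_rpow, ← ENNReal.ofReal_rpow_of_nonneg measureReal_nonneg (by norm_num),
      ofReal_measureReal]
  have hq : ENNReal.ofReal √(Q.real S) = Q S ^ (1 / 2 : ℝ) := by
    rw [Real.sqrt_eq_rpow, ← ENNReal.ofReal_rpow_of_nonneg measureReal_nonneg (by norm_num),
      ofReal_measureReal]
  have hi : ENNReal.ofReal √I.toReal = I ^ (1 / 2 : ℝ) := by
    rw [Real.sqrt_eq_rpow, ← ENNReal.ofReal_rpow_of_nonneg ENNReal.toReal_nonneg (by norm_num),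
      ENNReal.ofReal_toReal h]
  rw [← hp, ← hq, ← hi, ← ENNReal.ofReal_add (by positivity) (by positivity),
    ENNReal.ofReal_le_ofReal_iff (by positivity)] at h1 h2
  refine ENNReal.ofReal_le_of_le_toReal ?_
  rw [← Real.sq_sqrt (ENNReal.toReal_nonneg (a := I))]
  refine sq_le_sq' ?_ ?_ <;> linarith

/-- Data processing for the squared Hellinger distance and a finite-valued map. -/
theorem ofReal_sum_sqrt_sub_sq_le [IsFiniteMeasure P] [IsFiniteMeasure Q] [SigmaFinite μ]
    (hP : P ≪ μ) (hQ : Q ≪ μ) {A : Type*} [Fintype A] {s : Ω → A}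
    (hs : ∀ a, MeasurableSet (s ⁻¹' {a})) :
    ENNReal.ofReal (∑ a, (√(P.real (s ⁻¹' {a})) - √(Q.real (s ⁻¹' {a}))) ^ 2) ≤
      hellingerSq P Q μ := by
  rw [ENNReal.ofReal_sum_of_nonneg fun _ _ => sq_nonneg _]
  refine (Finset.sum_le_sum fun a _ => ofReal_sqrt_sub_sq_le hP hQ _).trans ?_
  rw [← lintegral_biUnion_finset _ fun a _ => hs a]
  · exact setLIntegral_le_lintegral _ _
  · intro a _ a' _ haa'
    exact Disjoint.preimage _ (by simpa using haa')

end DataProcessing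

/-! #### Pointwise inequalities -/

/-- Since `2 / γ ≥ 1`, the map `t ↦ t ^ (2 / γ)` is superadditive on `[0, ∞)`; apply this to `√q`
and `√p - √q`. -/
theorem sqrt_sub_sqrt_sq_le_rpow {γ : ℝ} (h1 : 1 ≤ γ) (h2 : γ ≤ 2) {p q : ℝ} (hp : 0 ≤ p)
    (hq : 0 ≤ q) : (√p - √q) ^ 2 ≤ |p ^ (1 / γ) - q ^ (1 / γ)| ^ γ := by
  wlog h : q ≤ p generalizing p q
  · rw [sub_sq_comm, abs_sub_comm]
    exact this hq hp (le_of_not_ge h)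
  have hγ : 0 < γ := by linarith
  have hd : 0 ≤ √p - √q := sub_nonneg.2 (Real.sqrt_le_sqrt h)
  have e (x : ℝ) (hx : 0 ≤ x) : x ^ (1 / γ) = √x ^ (2 / γ) := by
    rw [Real.sqrt_eq_rpow, ← Real.rpow_mul hx]; congr 1; ring
  have hs : √q ^ (2 / γ) + (√p - √q) ^ (2 / γ) ≤ √p ^ (2 / γ) := by
    have := Real.add_rpow_le_rpow_add (Real.sqrt_nonneg q) hd (p := 2 / γ)
      ((one_le_div hγ).2 h2)
    simpa using this
  have hpos : 0 ≤ (√p - √q) ^ (2 / γ) := Real.rpow_nonneg hd _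
  rw [e p hp, e q hq, abs_of_nonneg (by linarith)]
  calc (√p - √q) ^ 2 = ((√p - √q) ^ (2 / γ)) ^ γ := by
        rw [← Real.rpow_mul hd, div_mul_cancel₀ _ hγ.ne', Real.rpow_two]
    _ ≤ _ := Real.rpow_le_rpow hpos (by linarith) hγ.le

/-- The map `x ↦ x ^ (γ / 2)`, which sends `p ^ (1 / γ)` to `√p`, is `γ / 2`-Lipschitz on `[0, 1]`.
The bounds `p, q ≤ 1` hold for densities with respect to `P + Q`. -/
theorem sqrt_sub_sqrt_sq_le_of_two_le {γ : ℝ} (h2 : 2 ≤ γ) {p q : ℝ} (hp : 0 ≤ p)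
    (hq : 0 ≤ q) (hp1 : p ≤ 1) (hq1 : q ≤ 1) :
    (√p - √q) ^ 2 ≤ (γ / 2) ^ 2 * |p ^ (1 / γ) - q ^ (1 / γ)| ^ 2 := by
  wlog h : q ≤ p generalizing p q
  · rw [sub_sq_comm, abs_sub_comm]
    exact this hq hp hq1 hp1 (le_of_not_ge h)
  have hγ : 0 < γ := by linarith
  rw [← mul_pow]
  refine pow_le_pow_left₀ (sub_nonneg.2 (Real.sqrt_le_sqrt h)) ?_ 2
  set x := p ^ (1 / γ) with hx
  set y := q ^ (1 / γ) with hy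
  have e (t : ℝ) (ht : 0 ≤ t) : √t = (t ^ (1 / γ)) ^ (γ / 2) := by
    rw [Real.sqrt_eq_rpow, ← Real.rpow_mul ht]; congr 1; field_simp
  rw [e p hp, e q hq, ← hx, ← hy]
  have hx0 : 0 ≤ x := Real.rpow_nonneg hp _
  have hy0 : 0 ≤ y := Real.rpow_nonneg hq _
  have hx1 : x ≤ 1 := Real.rpow_le_one hp hp1 (by positivity)
  have hyx : y ≤ x := Real.rpow_le_rpow hq h (by positivity)
  rw [abs_of_nonneg (sub_nonneg.2 hyx)]
  rcases hx0.eq_or_lt with h0 | h0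
  · have : y = x := by linarith
    simp [this]
  -- Bernoulli's inequality at the ratio `y / x` replaces the mean value theorem.
  have hB := one_add_mul_self_le_rpow_one_add (s := y / x - 1) (p := γ / 2)
    (by have := div_nonneg hy0 hx0; linarith) (by linarith)
  rw [add_sub_cancel, Real.div_rpow hy0 hx0] at hB
  have hxp : 0 < x ^ (γ / 2) := Real.rpow_pos_of_pos h0 _
  have hB' : x ^ (γ / 2) - y ^ (γ / 2) ≤ γ / 2 * ((x - y) / x) * x ^ (γ / 2) := by
    rw [le_div_iff₀ hxp] at hB
    have : (x - y) / x = 1 - y / x := by field_simp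
    rw [this]
    linarith
  refine hB'.trans ?_
  have hxx : x ^ (γ / 2) ≤ x := by
    simpa using Real.rpow_le_rpow_of_exponent_ge h0 hx1 (by linarith : (1 : ℝ) ≤ γ / 2)
  calc γ / 2 * ((x - y) / x) * x ^ (γ / 2) ≤ γ / 2 * ((x - y) / x) * x := by
        have : 0 ≤ (x - y) / x := div_nonneg (sub_nonneg.2 hyx) hx0
        gcongr
    _ = γ / 2 * (x - y) := by field_simp

/-- A quantitative form of Young's inequality. -/
theorem rpow_mul_rpow_add_le {γ : ℝ} (h0 : 0 < γ) (h1 : γ < 1) {p q : ℝ} (hp : 0 ≤ p)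
    (hq : 0 ≤ q) :
    p ^ γ * q ^ (1 - γ) + min γ (1 - γ) * (√p - √q) ^ 2 ≤ γ * p + (1 - γ) * q := by
  have key {γ p q : ℝ} (h0 : 0 < γ) (h1 : γ ≤ 1 / 2) (hp : 0 ≤ p) (hq : 0 ≤ q) :
      p ^ γ * q ^ (1 - γ) + γ * (√p - √q) ^ 2 ≤ γ * p + (1 - γ) * q := by
    -- Weighting `√(p q)` and `q`, rather than `p` and `q`, leaves the gap visible: `2 γ √(p q) = γ
    -- (p + q - (√p - √q)²)`.
    have hY := Real.geom_mean_le_arith_mean2_weighted (w₁ := 2 * γ) (w₂ := 1 - 2 * γ)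
      (p₁ := √p * √q) (p₂ := q) (by linarith) (by linarith) (by positivity) hq (by ring)
    have e : (√p * √q) ^ (2 * γ) * q ^ (1 - 2 * γ) = p ^ γ * q ^ (1 - γ) := by
      rcases hq.eq_or_lt with hq0 | hq0
      · subst hq0
        rw [Real.sqrt_zero, mul_zero, Real.zero_rpow (by positivity : 2 * γ ≠ 0),
          Real.zero_rpow (by linarith : 1 - γ ≠ 0), zero_mul, mul_zero]
      · rw [Real.mul_rpow (by positivity) (by positivity), Real.sqrt_eq_rpow, Real.sqrt_eq_rpow,
          ← Real.rpow_mul hp, ← Real.rpow_mul hq, mul_assoc, ← Real.rpow_add hq0]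
        congr 2 <;> ring
    rw [e] at hY
    nlinarith [Real.sq_sqrt hp, Real.sq_sqrt hq]
  rcases le_total γ (1 / 2) with h | h
  · rw [min_eq_left (by linarith)]
    exact key h0 h hp hq
  · rw [min_eq_right (by linarith)]
    have := key (γ := 1 - γ) (by linarith) (by linarith) hq hp
    rw [sub_sub_cancel, sub_sq_comm, mul_comm] at this
    linarith

/-- From `log t = 2 log √t ≥ 2 (1 - 1 / √t)` for `t > 0`. -/
theorem sqrt_sub_one_sq_le_klFun {t : ℝ} (ht : 0 ≤ t) :
    (√t - 1) ^ 2 ≤ InformationTheory.klFun t := by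
  rcases ht.eq_or_lt with h | h
  · simp [← h, InformationTheory.klFun]
  have h1 := Real.one_sub_inv_le_log_of_pos (Real.sqrt_pos.2 h)
  have h2 := Real.sq_sqrt ht
  have h3 : Real.log t = 2 * Real.log √t := by rw [Real.log_sqrt ht]; ring
  have h4 : t * (1 - (√t)⁻¹) = t - √t := by
    have : √t ≠ 0 := (Real.sqrt_pos.2 h).ne'
    nth_rewrite 1 [← h2]; field_simp
    linarith
  rw [InformationTheory.klFun, h3]
  nlinarith [mul_le_mul_of_nonneg_left h1 ht]

/-- By homogeneity take `q = 1`. Then `t ^ γ = t exp((γ - 1) log t) ≥ t + (γ - 1) t log t`, and the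
bound on `klFun` finishes. -/
theorem add_sqrt_sub_sqrt_sq_le_rpow {γ : ℝ} (h1 : 1 < γ) {p q : ℝ} (hp : 0 ≤ p) (hq : 0 < q) :
    γ * p + (γ - 1) * (√p - √q) ^ 2 ≤ p ^ γ * q ^ (1 - γ) + (γ - 1) * q := by
  have key {t : ℝ} (ht : 0 ≤ t) : γ * t + (γ - 1) * (√t - 1) ^ 2 ≤ t ^ γ + (γ - 1) := by
    have hk := sqrt_sub_one_sq_le_klFun ht
    rcases ht.eq_or_lt with h | h
    · rw [← h, Real.zero_rpow (by linarith)]; simp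
    have e : t * (1 + (γ - 1) * Real.log t) ≤ t ^ γ := by
      have := Real.add_one_le_exp ((γ - 1) * Real.log t)
      calc t * (1 + (γ - 1) * Real.log t) ≤ t * Real.exp ((γ - 1) * Real.log t) := by
            gcongr; linarith
        _ = t ^ (1 : ℝ) * t ^ (γ - 1) := by
            rw [Real.rpow_one, Real.rpow_def_of_pos h (γ - 1), mul_comm (γ - 1)]
        _ = t ^ γ := by rw [← Real.rpow_add h]; congr 1; ring
    rw [InformationTheory.klFun] at hk
    nlinarith [mul_le_mul_of_nonneg_left hk (by linarith : 0 ≤ γ - 1)]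
  have h := mul_le_mul_of_nonneg_left (key (div_nonneg hp hq.le)) hq.le
  have e1 : q * (p / q) ^ γ = p ^ γ * q ^ (1 - γ) := by
    rw [Real.div_rpow hp hq.le, Real.rpow_sub hq, Real.rpow_one]; field_simp
  have e2 : q * (√(p / q) - 1) ^ 2 = (√p - √q) ^ 2 := by
    have hs : √q ≠ 0 := (Real.sqrt_pos.2 hq).ne'
    nth_rewrite 1 [← Real.sq_sqrt hq.le]
    rw [Real.sqrt_div hp, ← mul_pow]; congr 1; field_simp
  have e3 : q * (γ * (p / q)) = γ * p := by field_simp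
  rw [mul_add, mul_add, e1, e3] at h
  rw [mul_left_comm, e2] at h
  linarith

/-! ### Bounding the squared Hellinger distance by the generalized Hellinger distance and the Rényi
divergence. -/

section Comparison

variable {Ω : Type*} [MeasurableSpace Ω] (P Q : Measure Ω)

theorem absolutelyContinuous_add_right : Q ≪ P + Q := by
  rw [add_comm]; exact Measure.AbsolutelyContinuous.rfl.add_right P

theorem lintegral_rnDeriv_add_left [IsFiniteMeasure P] [IsFiniteMeasure Q] :
    ∫⁻ x, P.rnDeriv (P + Q) x ∂(P + Q) = P Set.univ :=
  Measure.lintegral_rnDeriv (Measure.AbsolutelyContinuous.rfl.add_right Q)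

theorem lintegral_rnDeriv_add_right [IsFiniteMeasure P] [IsFiniteMeasure Q] :
    ∫⁻ x, Q.rnDeriv (P + Q) x ∂(P + Q) = Q Set.univ :=
  Measure.lintegral_rnDeriv (absolutelyContinuous_add_right P Q)

theorem hellingerDist_rpow {γ : ℝ} (hγ : 0 < γ) :
    2 * hellingerDist γ P Q ^ γ = ∫⁻ x, ENNReal.ofReal
      |(P.rnDeriv (P + Q) x).toReal ^ (1 / γ) - (Q.rnDeriv (P + Q) x).toReal ^ (1 / γ)| ^ γ
        ∂(P + Q) := by
  rw [hellingerDist, ← ENNReal.rpow_mul, one_div_mul_cancel hγ.ne', ENNReal.rpow_one, ← mul_assoc,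
    ENNReal.mul_inv_cancel two_ne_zero ENNReal.ofNat_ne_top, one_mul]

theorem hellingerSq_le_of_le_two {γ : ℝ} (h1 : 1 ≤ γ) (h2 : γ ≤ 2) :
    hellingerSq P Q (P + Q) ≤ 2 * hellingerDist γ P Q ^ γ := by
  rw [hellingerDist_rpow P Q (by linarith), hellingerSq]
  refine lintegral_mono fun x => ?_
  rw [ENNReal.ofReal_rpow_of_nonneg (abs_nonneg _) (by linarith)]
  exact ENNReal.ofReal_le_ofReal
    (sqrt_sub_sqrt_sq_le_rpow h1 h2 ENNReal.toReal_nonneg ENNReal.toReal_nonneg)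

theorem hellingerSq_le_of_two_lt [IsProbabilityMeasure P] [IsProbabilityMeasure Q] {γ : ℝ}
    (h2 : 2 < γ) :
    hellingerSq P Q (P + Q) ≤ ENNReal.ofReal (γ ^ 2 / 2) * hellingerDist γ P Q ^ 2 := by
  have hγ : 0 < γ := by linarith
  set D : Ω → ℝ≥0∞ := fun x => ENNReal.ofReal
    |(P.rnDeriv (P + Q) x).toReal ^ (1 / γ) - (Q.rnDeriv (P + Q) x).toReal ^ (1 / γ)| with hD
  have mD : Measurable D := by fun_prop
  have hP1 : ∀ᵐ x ∂(P + Q), P.rnDeriv (P + Q) x ≤ 1 :=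
    Measure.rnDeriv_le_one_of_le (Measure.le_add_right le_rfl)
  have hQ1 : ∀ᵐ x ∂(P + Q), Q.rnDeriv (P + Q) x ≤ 1 :=
    Measure.rnDeriv_le_one_of_le (Measure.le_add_left le_rfl)
  have hstep : hellingerSq P Q (P + Q) ≤
      ENNReal.ofReal ((γ / 2) ^ 2) * ∫⁻ x, D x ^ (2 : ℝ) ∂(P + Q) := by
    rw [← lintegral_const_mul _ (by fun_prop), hellingerSq]
    refine lintegral_mono_ae ?_
    filter_upwards [hP1, hQ1] with x hp hq
    rw [hD, ENNReal.ofReal_rpow_of_nonneg (abs_nonneg _) (by norm_num),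
      ← ENNReal.ofReal_mul (by positivity), Real.rpow_two]
    exact ENNReal.ofReal_le_ofReal (sqrt_sub_sqrt_sq_le_of_two_le h2.le ENNReal.toReal_nonneg
      ENNReal.toReal_nonneg (ENNReal.toReal_le_of_le_ofReal zero_le_one (by simpa using hp))
      (ENNReal.toReal_le_of_le_ofReal zero_le_one (by simpa using hq)))
  -- Hölder against the constant `1`, where `P + Q` has mass `2`: `∫ D² ≤ (2 H^γ)^(2/γ) · 2^(1 -
  -- 2/γ) = 2 H²`, with `H` the `γ`-Hellinger distance. With `(γ / 2)²` this yields `γ² / 2`.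
  have hconj := Real.HolderConjugate.conjExponent (p := γ / 2) (by linarith)
  have hH := ENNReal.lintegral_mul_le_Lp_mul_Lq (P + Q) hconj (f := fun x => D x ^ (2 : ℝ))
    (g := fun _ => 1) (by fun_prop) (by fun_prop)
  simp only [Pi.mul_apply, mul_one, ENNReal.one_rpow, lintegral_const, one_mul,
    Measure.add_apply, measure_univ, ← ENNReal.rpow_mul] at hH
  rw [show (2 : ℝ) * (γ / 2) = γ by ring, ← hellingerDist_rpow P Q hγ,
    ENNReal.mul_rpow_of_nonneg _ _ (by positivity), ← ENNReal.rpow_mul,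
    show γ * (1 / (γ / 2)) = (2 : ℝ) by field_simp, mul_right_comm, one_add_one_eq_two,
    ← ENNReal.rpow_add _ _ two_ne_zero ENNReal.ofNat_ne_top, one_div, one_div,
    hconj.inv_add_inv_eq_one, ENNReal.rpow_one, ENNReal.rpow_two] at hH
  refine hstep.trans ((mul_le_mul_right hH _).trans (le_of_eq ?_))
  rw [← mul_assoc]
  congr 1
  rw [show (2 : ℝ≥0∞) = ENNReal.ofReal 2 by simp, ← ENNReal.ofReal_mul (by positivity)]
  congr 1; ring

theorem renyiDiv_eq_ofReal {γ : ℝ} (hγ : γ ≠ 1)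
    (h0 : ∫⁻ x, P.rnDeriv (P + Q) x ^ γ * Q.rnDeriv (P + Q) x ^ (1 - γ) ∂(P + Q) ≠ 0)
    (ht : ∫⁻ x, P.rnDeriv (P + Q) x ^ γ * Q.rnDeriv (P + Q) x ^ (1 - γ) ∂(P + Q) ≠ ⊤) :
    renyiDiv γ P Q = ENNReal.ofReal ((γ - 1)⁻¹ * Real.log
      (∫⁻ x, P.rnDeriv (P + Q) x ^ γ * Q.rnDeriv (P + Q) x ^ (1 - γ) ∂(P + Q)).toReal) := by
  rw [renyiDiv, if_neg hγ, ENNReal.log_pos_real h0 ht, ← EReal.coe_mul,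
    EReal.toENNReal_of_ne_top (EReal.coe_ne_top _), EReal.toReal_coe]

variable [IsProbabilityMeasure P] [IsProbabilityMeasure Q]

/-- Integrating the quantitative Young inequality gives `m · hellingerSq ≤ 1 - I`, and `1 - I ≤ -log
I`, which is `1 - γ` times the divergence. When `I = 0` the divergence is infinite. -/
theorem hellingerSq_le_renyiDiv_of_lt_one {γ : ℝ} (h0 : 0 < γ) (h1 : γ < 1) :
    hellingerSq P Q (P + Q) ≤ ENNReal.ofReal ((1 - γ) / min γ (1 - γ)) * renyiDiv γ P Q := by
  set m := min γ (1 - γ) with hm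
  have hm0 : 0 < m := lt_min h0 (by linarith)
  set I := ∫⁻ x, P.rnDeriv (P + Q) x ^ γ * Q.rnDeriv (P + Q) x ^ (1 - γ) ∂(P + Q) with hI
  have hbound : I + ENNReal.ofReal m * hellingerSq P Q (P + Q) ≤ 1 := by
    have hone : ∫⁻ x, (ENNReal.ofReal γ * P.rnDeriv (P + Q) x +
        ENNReal.ofReal (1 - γ) * Q.rnDeriv (P + Q) x) ∂(P + Q) = 1 := by
      rw [lintegral_add_left (by fun_prop), lintegral_const_mul _ (by fun_prop),
        lintegral_const_mul _ (by fun_prop), lintegral_rnDeriv_add_left,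
        lintegral_rnDeriv_add_right, measure_univ, measure_univ, mul_one, mul_one,
        ← ENNReal.ofReal_add h0.le (by linarith)]
      simp
    rw [← hone, hI, hellingerSq, ← lintegral_const_mul _ (by fun_prop),
      ← lintegral_add_left (by fun_prop)]
    refine lintegral_mono_ae ?_
    filter_upwards [P.rnDeriv_lt_top (P + Q), Q.rnDeriv_lt_top (P + Q)] with x hp hq
    lift P.rnDeriv (P + Q) x to ℝ≥0 using hp.ne with p
    lift Q.rnDeriv (P + Q) x to ℝ≥0 using hq.ne with q
    have := rpow_mul_rpow_add_le h0 h1 p.coe_nonneg q.coe_nonneg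
    simp only [← ENNReal.ofReal_coe_nnreal, ENNReal.toReal_ofReal NNReal.zero_le_coe]
    rw [ENNReal.ofReal_rpow_of_nonneg p.coe_nonneg h0.le, ENNReal.ofReal_rpow_of_nonneg q.coe_nonneg (by linarith),
      ← ENNReal.ofReal_mul (by positivity), ← ENNReal.ofReal_mul (by positivity),
      ← ENNReal.ofReal_mul (by positivity), ← ENNReal.ofReal_mul (by linarith),
      ← ENNReal.ofReal_add (by positivity) (by positivity), ← ENNReal.ofReal_add (by positivity)
        (mul_nonneg (by linarith) q.coe_nonneg)]
    exact ENNReal.ofReal_le_ofReal this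
  have hI1 : I ≤ 1 := le_self_add.trans hbound
  have hIt : I ≠ ⊤ := ne_top_of_le_ne_top ENNReal.one_ne_top hI1
  have hconst : ENNReal.ofReal m * ENNReal.ofReal ((1 - γ) / m) = ENNReal.ofReal (1 - γ) := by
    rw [← ENNReal.ofReal_mul hm0.le]; congr 1; field_simp
  have hm' : ENNReal.ofReal m ≠ 0 := by simpa using hm0
  rw [← ENNReal.mul_le_mul_iff_right hm' ENNReal.ofReal_ne_top, ← mul_assoc, hconst]
  rcases eq_or_ne I 0 with hI0 | hI0
  · have : renyiDiv γ P Q = ⊤ := by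
      rw [renyiDiv, if_neg h1.ne, ← hI, hI0, ENNReal.log_zero, EReal.coe_mul_bot_of_neg
        (inv_lt_zero.2 (by linarith)), EReal.toENNReal_top]
    rw [this, ENNReal.mul_top (by simpa using h1)]
    exact le_top
  · rw [renyiDiv_eq_ofReal P Q h1.ne hI0 hIt, ← ENNReal.ofReal_mul (by linarith), ← hI]
    calc ENNReal.ofReal m * hellingerSq P Q (P + Q) ≤ 1 - I :=
          ENNReal.le_sub_of_add_le_left hIt hbound
      _ = ENNReal.ofReal (1 - I.toReal) := by
          rw [ENNReal.ofReal_sub _ ENNReal.toReal_nonneg, ENNReal.ofReal_toReal hIt,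
            ENNReal.ofReal_one]
      _ ≤ _ := by
          refine ENNReal.ofReal_le_ofReal ?_
          have e : (1 - γ) * ((γ - 1)⁻¹ * Real.log I.toReal) = - Real.log I.toReal := by
            have : γ - 1 ≠ 0 := by linarith
            field_simp
            ring
          rw [e]
          linarith [Real.log_le_sub_one_of_pos (ENNReal.toReal_pos hI0 hIt)]

theorem hellingerSq_le_two : hellingerSq P Q (P + Q) ≤ 2 := by
  have : ∫⁻ x, (P.rnDeriv (P + Q) x + Q.rnDeriv (P + Q) x) ∂(P + Q) = 2 := by
    rw [lintegral_add_left (by fun_prop), lintegral_rnDeriv_add_left,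
      lintegral_rnDeriv_add_right, measure_univ, measure_univ, one_add_one_eq_two]
  rw [← this, hellingerSq]
  refine lintegral_mono_ae ?_
  filter_upwards [P.rnDeriv_lt_top (P + Q), Q.rnDeriv_lt_top (P + Q)] with x hp hq
  lift P.rnDeriv (P + Q) x to ℝ≥0 using hp.ne with p
  lift Q.rnDeriv (P + Q) x to ℝ≥0 using hq.ne with q
  rw [← ENNReal.coe_add, ENNReal.ofReal_le_iff_le_toReal (by finiteness)]
  simp only [ENNReal.coe_toReal, NNReal.coe_add]
  nlinarith [Real.sq_sqrt p.coe_nonneg, Real.sq_sqrt q.coe_nonneg,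
    mul_nonneg (Real.sqrt_nonneg p) (Real.sqrt_nonneg q)]

/-- The integrated pointwise bound reads `I ≥ 1 + s` with `s = (γ - 1) H`. Then `log I ≥ s / (1 +
s)`, and `H ≤ 2` gives `1 + s ≤ 2 γ - 1`, the constant. -/
theorem hellingerSq_le_renyiDiv_of_one_lt {γ : ℝ} (h1 : 1 < γ) :
    hellingerSq P Q (P + Q) ≤ ENNReal.ofReal (2 * γ - 1) * renyiDiv γ P Q := by
  set I := ∫⁻ x, P.rnDeriv (P + Q) x ^ γ * Q.rnDeriv (P + Q) x ^ (1 - γ) ∂(P + Q) with hI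
  set H := hellingerSq P Q (P + Q) with hH
  have hbound : ENNReal.ofReal γ + ENNReal.ofReal (γ - 1) * H ≤ I + ENNReal.ofReal (γ - 1) := by
    have e1 : ENNReal.ofReal γ = ∫⁻ x, ENNReal.ofReal γ * P.rnDeriv (P + Q) x ∂(P + Q) := by
      rw [lintegral_const_mul _ (by fun_prop), lintegral_rnDeriv_add_left, measure_univ, mul_one]
    have e2 : ENNReal.ofReal (γ - 1) =
        ∫⁻ x, ENNReal.ofReal (γ - 1) * Q.rnDeriv (P + Q) x ∂(P + Q) := by
      rw [lintegral_const_mul _ (by fun_prop), lintegral_rnDeriv_add_right, measure_univ, mul_one]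
    nth_rewrite 2 [e2]
    rw [e1, hH, hI, hellingerSq, ← lintegral_const_mul _ (by fun_prop),
      ← lintegral_add_left (by fun_prop), ← lintegral_add_left (by fun_prop)]
    refine lintegral_mono_ae ?_
    filter_upwards [P.rnDeriv_lt_top (P + Q), Q.rnDeriv_lt_top (P + Q)] with x hp hq
    lift P.rnDeriv (P + Q) x to ℝ≥0 using hp.ne with p
    lift Q.rnDeriv (P + Q) x to ℝ≥0 using hq.ne with q
    -- The real inequality needs `q > 0`; where `p > 0 = q` the integrand is `∞`.
    rcases eq_or_ne q 0 with hq0 | hq0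
    · rcases eq_or_ne p 0 with hp0 | hp0
      · simp [hq0, hp0]
      · have : (p : ℝ≥0∞) ^ γ * (q : ℝ≥0∞) ^ (1 - γ) = ⊤ := by
          rw [hq0, ENNReal.coe_zero, ENNReal.zero_rpow_of_neg (by linarith), ENNReal.mul_top]
          simp [hp0, ENNReal.rpow_eq_zero_iff]
        rw [this, top_add]
        exact le_top
    have hq1 : 0 < (q : ℝ) := NNReal.coe_pos.2 (pos_iff_ne_zero.2 hq0)
    have := add_sqrt_sub_sqrt_sq_le_rpow h1 p.coe_nonneg hq1
    have hg : 0 ≤ γ - 1 := by linarith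
    have hg' : 0 ≤ γ := by linarith
    simp only [← ENNReal.ofReal_coe_nnreal, ENNReal.toReal_ofReal NNReal.zero_le_coe]
    rw [ENNReal.ofReal_rpow_of_nonneg p.coe_nonneg hg', ENNReal.ofReal_rpow_of_pos hq1,
      ← ENNReal.ofReal_mul (by positivity), ← ENNReal.ofReal_mul (by positivity),
      ← ENNReal.ofReal_mul (by positivity), ← ENNReal.ofReal_mul (by positivity),
      ← ENNReal.ofReal_add (by positivity) (by positivity), ← ENNReal.ofReal_add (by positivity)
        (by positivity)]
    exact ENNReal.ofReal_le_ofReal this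
  have hC : ENNReal.ofReal (2 * γ - 1) ≠ 0 := by simp; linarith
  rcases eq_or_ne I ⊤ with hIt | hIt
  · have : renyiDiv γ P Q = ⊤ := by
      rw [renyiDiv, if_neg h1.ne', ← hI, hIt, ENNReal.log_top, EReal.coe_mul_top_of_pos
        (inv_pos.2 (by linarith)), EReal.toENNReal_top]
    rw [this, ENNReal.mul_top hC]
    exact le_top
  have hH2 : H ≤ 2 := hellingerSq_le_two P Q
  have hHt : H ≠ ⊤ := ne_top_of_le_ne_top ENNReal.ofNat_ne_top hH2
  lift H to ℝ≥0 using hHt with η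
  have hη : (η : ℝ) ≤ 2 := by exact_mod_cast hH2
  have hη0 : (0 : ℝ) ≤ η := η.2
  have hg : 0 < γ - 1 := by linarith
  have hx : 1 + (γ - 1) * η ≤ I.toReal := by
    have := ENNReal.toReal_mono (by finiteness) hbound
    rw [ENNReal.toReal_add (by finiteness) (by finiteness), ENNReal.toReal_mul,
      ENNReal.toReal_ofReal (by linarith), ENNReal.toReal_ofReal hg.le,
      ENNReal.toReal_add hIt (by finiteness), ENNReal.toReal_ofReal hg.le,
      ENNReal.coe_toReal] at this
    linarith
  have hy : 0 ≤ (γ - 1) * η := by positivity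
  have hI0 : I ≠ 0 := by
    intro h
    rw [h, ENNReal.toReal_zero] at hx
    linarith
  rw [renyiDiv_eq_ofReal P Q h1.ne' hI0 hIt, ← ENNReal.ofReal_mul (by linarith), ← hI,
    ← ENNReal.ofReal_coe_nnreal]
  refine ENNReal.ofReal_le_ofReal ?_
  have hlog : (γ - 1) * η / (1 + (γ - 1) * η) ≤ Real.log I.toReal := by
    refine le_trans ?_ (Real.log_le_log (by linarith) hx)
    refine le_trans (le_of_eq ?_) (Real.one_sub_inv_le_log_of_pos (by linarith))
    have : 1 + (γ - 1) * (η : ℝ) ≠ 0 := by linarith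
    rw [eq_sub_iff_add_eq, div_add' _ _ _ this, div_eq_one_iff_eq this, inv_mul_cancel₀ this]
    ring
  have h2 : (γ - 1) * η / (2 * γ - 1) ≤ Real.log I.toReal := by
    refine le_trans ?_ hlog
    refine div_le_div_of_nonneg_left hy (by linarith) ?_
    nlinarith
  rw [div_le_iff₀ (by linarith)] at h2
  rw [← mul_le_mul_iff_right₀ hg]
  refine h2.trans (le_of_eq ?_)
  field_simp

theorem hellingerSq_le_klDiv (h : P ≪ Q) : hellingerSq P Q Q ≤ InformationTheory.klDiv P Q := by
  rw [InformationTheory.klDiv_eq_lintegral_klFun, if_pos h, hellingerSq]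
  refine lintegral_mono_ae ?_
  filter_upwards [Measure.rnDeriv_self Q] with x hx
  rw [hx, ENNReal.toReal_one, Real.sqrt_one]
  exact ENNReal.ofReal_le_ofReal (sqrt_sub_one_sq_le_klFun ENNReal.toReal_nonneg)

/-- `P` and `Q` are within `e` in squared Hellinger distance after any discretization. -/
def HellingerSqLE (P Q : Measure Ω) (e : ℝ≥0∞) : Prop :=
  ∀ (A : Type) [Fintype A] (s : Ω → A), (∀ a, MeasurableSet (s ⁻¹' {a})) →
    ENNReal.ofReal (∑ a, (√(P.real (s ⁻¹' {a})) - √(Q.real (s ⁻¹' {a}))) ^ 2) ≤ e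

variable {P Q} in
theorem HellingerSqLE.of_le {e : ℝ≥0∞} (h : hellingerSq P Q (P + Q) ≤ e) :
    HellingerSqLE P Q e := fun _ _ _ hs =>
  (ofReal_sum_sqrt_sub_sq_le (Measure.AbsolutelyContinuous.rfl.add_right Q)
    (absolutelyContinuous_add_right P Q) hs).trans h

/-- The discretized squared Hellinger distances are bounded by the Rényi divergence. -/
theorem exists_hellingerSqLE_renyiDiv {γ : ℝ} (h0 : 0 < γ) :
    ∃ C : ℝ≥0, ∀ {Ω : Type u} [MeasurableSpace Ω] (P Q : Measure Ω) [IsProbabilityMeasure P]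
      [IsProbabilityMeasure Q], HellingerSqLE P Q (C * renyiDiv γ P Q) := by
  rcases lt_trichotomy γ 1 with h | h | h
  · exact ⟨_, fun P Q _ _ => .of_le (hellingerSq_le_renyiDiv_of_lt_one P Q h0 h)⟩
  · refine ⟨1, fun P Q _ _ A _ s hs => ?_⟩
    rw [renyiDiv, if_pos h, ENNReal.coe_one, one_mul]
    -- Here `Q` itself is the dominating measure, as in the `klFun` formula. The discretized notion
    -- does not mention a dominating measure, so the three cases fit together.
    by_cases hPQ : P ≪ Q
    · exact (ofReal_sum_sqrt_sub_sq_le hPQ .rfl hs).trans (hellingerSq_le_klDiv P Q hPQ)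
    · rw [InformationTheory.klDiv_of_not_ac hPQ]
      exact le_top
  · exact ⟨_, fun P Q _ _ => .of_le (hellingerSq_le_renyiDiv_of_one_lt P Q h)⟩

end Comparison

/-! ### Bin labels -/

theorem DoubleBinning.exists_mem_fine {Z : Type*} [MeasurableSpace Z] {M b : ℕ}
    (B : DoubleBinning Z M b) (z : Z) : ∃ j : Fin M × Fin b, z ∈ B.fine j.1 j.2 := by
  have h : z ∈ ⋃ m, B.coarse m := B.coarse_cover ▸ Set.mem_univ z
  obtain ⟨m, hm⟩ := Set.mem_iUnion.1 h
  rw [← B.fine_cover m] at hm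
  obtain ⟨k, hk⟩ := Set.mem_iUnion.1 hm
  exact ⟨(m, k), hk⟩

/-- The label of the fine bin that contains a point. -/
def DoubleBinning.label {Z : Type*} [MeasurableSpace Z] {M b : ℕ}
    (B : DoubleBinning Z M b) (z : Z) : Fin M × Fin b :=
  (B.exists_mem_fine z).choose

section Label

variable {Z : Type*} [MeasurableSpace Z] {M b : ℕ} (B : DoubleBinning Z M b)

theorem DoubleBinning.mem_fine_label (z : Z) : z ∈ B.fine (B.label z).1 (B.label z).2 :=
  (B.exists_mem_fine z).choose_spec

theorem DoubleBinning.fine_subset_coarse (m : Fin M) (k : Fin b) : B.fine m k ⊆ B.coarse m := by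
  rw [← B.fine_cover m]
  exact Set.subset_iUnion _ k

theorem DoubleBinning.coarse_eq_preimage (m : Fin M) :
    B.coarse m = B.label ⁻¹' {j | j.1 = m} := by
  ext z
  have hz := B.fine_subset_coarse _ _ (B.mem_fine_label z)
  constructor
  · intro h
    by_contra hne
    exact Set.disjoint_left.1 (B.coarse_disjoint hne) hz h
  · rintro rfl
    exact hz

theorem DoubleBinning.fine_eq_preimage (m : Fin M) (k : Fin b) :
    B.fine m k = B.label ⁻¹' {(m, k)} := by
  ext z
  constructor
  · intro h
    have h1 : (B.label z).1 = m := by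
      have := B.fine_subset_coarse m k h
      rwa [B.coarse_eq_preimage] at this
    subst h1
    by_contra hne
    have hk : (B.label z).2 ≠ k := fun hk => hne (Prod.ext rfl hk)
    exact Set.disjoint_left.1 (B.fine_disjoint _ hk) (B.mem_fine_label z) h
  · intro h
    have := B.mem_fine_label z
    rwa [Set.mem_singleton_iff.1 h] at this

theorem DoubleBinning.measurable_label : Measurable B.label :=
  measurable_to_countable' fun j => by
    rw [← B.fine_eq_preimage j.1 j.2]
    exact B.fine_measurable _ _

/-- The tautological double binning of the space of bin labels. -/
def labelBinning (M b : ℕ) : DoubleBinning (Fin M × Fin b) M b where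
  coarse m := {j | j.1 = m}
  fine m k := {(m, k)}
  coarse_disjoint m m' h := Set.disjoint_left.2 fun j h1 h2 => h (h1.symm.trans h2)
  coarse_cover := by ext; simp
  fine_disjoint m k k' h := by simpa using h
  fine_cover m := by
    ext j
    simp only [Set.mem_iUnion, Set.mem_singleton_iff, Set.mem_ofPred_eq]
    constructor
    · rintro ⟨k, rfl⟩
      rfl
    · rintro rfl
      exact ⟨j.2, rfl⟩
  fine_measurable _ _ := measurableSet_singleton _

variable {X Y : Type*} {n : ℕ}

/-- The test uses `z` only through membership in bins, so once the bins are preimages both sides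
agree by definition. -/
theorem permTest_comap {Z' : Type*} [MeasurableSpace Z'] (B : DoubleBinning Z M b)
    (B' : DoubleBinning Z' M b) (g : Z → Z') (hc : B.coarse = fun m => g ⁻¹' B'.coarse m)
    (hf : B.fine = fun m k => g ⁻¹' B'.fine m k)
    (f : (Fin M → Σ s : ℕ, (Fin s → X × Y)) → ℝ) (α : ℝ) (w : Fin n → X × Y × Z) :
    permTest B f α w = permTest B' f α fun i => ((w i).1, (w i).2.1, g (w i).2.2) := by
  rcases B with ⟨c, φ, _, _, _, _, _⟩
  subst hc hf
  rfl

theorem permTest_label (f : (Fin M → Σ s : ℕ, (Fin s → X × Y)) → ℝ) (α : ℝ)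
    (w : Fin n → X × Y × Z) :
    permTest B f α w =
      permTest (labelBinning M b) f α fun i => ((w i).1, (w i).2.1, B.label (w i).2.2) :=
  permTest_comap B _ B.label (funext B.coarse_eq_preimage)
    (funext fun m => funext fun k => B.fine_eq_preimage m k) f α w

end Label

/-! ### Cyclic local permutations and the permutation p-value -/

section Perms

variable {X Y Z : Type*} [MeasurableSpace Z] {M b n : ℕ} (B : DoubleBinning Z M b)

theorem mem_cyclicLocalPerms {z : Fin n → Z} {π : Equiv.Perm (Fin n)} :
    π ∈ cyclicLocalPerms B z ↔ ∀ m k, ∃ c : ℕ, ∀ j : Fin (binIdx z (B.fine m k)).card,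
      π (nthIdx z (B.fine m k) j) =
        nthIdx z (B.fine m k) ⟨(j + c) % (binIdx z (B.fine m k)).card, Nat.mod_lt _ j.pos⟩ := by
  simp [cyclicLocalPerms]

theorem one_mem_cyclicLocalPerms (z : Fin n → Z) : 1 ∈ cyclicLocalPerms B z := by
  rw [mem_cyclicLocalPerms]
  refine fun m k => ⟨0, fun j => ?_⟩
  simp [Nat.mod_eq_of_lt j.2]

theorem mul_mem_cyclicLocalPerms {z : Fin n → Z} {σ τ : Equiv.Perm (Fin n)}
    (hσ : σ ∈ cyclicLocalPerms B z) (hτ : τ ∈ cyclicLocalPerms B z) :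
    σ * τ ∈ cyclicLocalPerms B z := by
  rw [mem_cyclicLocalPerms] at *
  intro m k
  obtain ⟨c, hc⟩ := hσ m k
  obtain ⟨d, hd⟩ := hτ m k
  refine ⟨d + c, fun j => ?_⟩
  rw [Equiv.Perm.mul_apply, hd, hc]
  congr 2
  simp [Nat.mod_add_mod, add_assoc]

theorem card_cyclicLocalPerms_pos (z : Fin n → Z) : 0 < (cyclicLocalPerms B z).card :=
  Finset.card_pos.2 ⟨1, one_mem_cyclicLocalPerms B z⟩

/-- Inverses are not needed: an injective translation of a finite set into itself is onto. -/
theorem image_mul_cyclicLocalPerms {z : Fin n → Z} {σ : Equiv.Perm (Fin n)}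
    (hσ : σ ∈ cyclicLocalPerms B z) :
    (cyclicLocalPerms B z).image (fun τ => σ * τ) = cyclicLocalPerms B z := by
  refine Finset.eq_of_subset_of_card_le ?_ ?_
  · intro τ hτ
    obtain ⟨ρ, hρ, rfl⟩ := Finset.mem_image.1 hτ
    exact mul_mem_cyclicLocalPerms B hσ hρ
  · rw [Finset.card_image_of_injective _ (mul_right_injective σ)]

theorem mem_fine_of_mem_cyclicLocalPerms {z : Fin n → Z} {σ : Equiv.Perm (Fin n)}
    (hσ : σ ∈ cyclicLocalPerms B z) {m : Fin M} {k : Fin b} {i : Fin n} (hi : z i ∈ B.fine m k) :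
    z (σ i) ∈ B.fine m k := by
  obtain ⟨c, hc⟩ := (mem_cyclicLocalPerms B).1 hσ m k
  have hi' : i ∈ binIdx z (B.fine m k) := by simpa [binIdx] using hi
  obtain ⟨j, rfl⟩ : ∃ j, nthIdx z (B.fine m k) j = i := by
    have h : i ∈ Set.range ((binIdx z (B.fine m k)).orderEmbOfFin rfl) := by
      rw [Finset.range_orderEmbOfFin]; exact hi'
    exact h
  rw [hc]
  have := (binIdx z (B.fine m k)).orderEmbOfFin_mem rfl
    ⟨(j + c) % (binIdx z (B.fine m k)).card, Nat.mod_lt _ j.pos⟩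
  simpa [binIdx, nthIdx] using this

theorem label_of_mem_cyclicLocalPerms {z : Fin n → Fin M × Fin b} {σ : Equiv.Perm (Fin n)}
    (hσ : σ ∈ cyclicLocalPerms (labelBinning M b) z) (i : Fin n) : z (σ i) = z i :=
  mem_fine_of_mem_cyclicLocalPerms (labelBinning M b) hσ (m := (z i).1) (k := (z i).2)
    (i := i) rfl

open Classical in
/-- Among a finite family of reals, the proportion of those whose upper rank is at most `c`. -/
theorem card_filter_rank_le {ι : Type*} (s : Finset ι) (t : ι → ℝ) {c : ℝ} (hc : 0 ≤ c) :
    ((s.filter fun i => ((s.filter fun j => t i ≤ t j).card : ℝ) ≤ c).card : ℝ) ≤ c := by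
  set S := s.filter fun i => ((s.filter fun j => t i ≤ t j).card : ℝ) ≤ c with hS
  rcases S.eq_empty_or_nonempty with h | h
  · simpa [h] using hc
  -- Every selected index has value at least `t i` for the minimizer `i`, so all of them are counted
  -- in the rank of `i`, which is at most `c`.
  · obtain ⟨i, hi, hmin⟩ := S.exists_min_image t h
    refine le_trans ?_ (Finset.mem_filter.1 hi).2
    exact_mod_cast Finset.card_le_card fun j hj =>
      Finset.mem_filter.2 ⟨(Finset.mem_filter.1 hj).1, hmin j hj⟩

open Classical in
/-- The p-values of the permuted data are valid under the uniform law on the permutations. -/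
theorem card_filter_pValue_le (f : (Fin M → Σ s : ℕ, (Fin s → X × Y)) → ℝ) {α : ℝ} (hα : 0 ≤ α)
    (x : Fin n → X) (y : Fin n → Y) (z : Fin n → Z) :
    (((cyclicLocalPerms B z).filter fun σ =>
      pValue B f x (fun i => y (σ i)) z ≤ α).card : ℝ) ≤ α * (cyclicLocalPerms B z).card := by
  set t : Equiv.Perm (Fin n) → ℝ := fun σ => statistic B f x (fun i => y (σ i)) z with ht
  have hN : (0 : ℝ) < (cyclicLocalPerms B z).card := by
    exact_mod_cast card_cyclicLocalPerms_pos B z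
  refine le_trans (le_of_eq ?_) (card_filter_rank_le (cyclicLocalPerms B z) t (by positivity))
  congr 2
  refine Finset.filter_congr fun σ hσ => ?_
  rw [pValue, div_le_iff₀ hN]
  -- Permuting by `π` the data already permuted by `σ` amounts to permuting by `σ * π`; reindexing
  -- makes the p-value the normalized rank of `t σ` in one fixed family.
  have hcard : ((cyclicLocalPerms B z).filter fun τ => t σ ≤ t τ).card =
      ((cyclicLocalPerms B z).filter fun π => t σ ≤ t (σ * π)).card := by
    nth_rewrite 1 [← image_mul_cyclicLocalPerms B hσ]
    rw [Finset.filter_image, Finset.card_image_of_injective _ (mul_right_injective σ)]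
  rw [hcard]
  rfl

/-- The empty sample has p-value `1`. It is treated apart because its error term is `0 · ∞ = 0` when
the within-bin bound is infinite. -/
theorem permTest_eq_zero (B : DoubleBinning Z M b)
    (f : (Fin M → Σ s : ℕ, (Fin s → X × Y)) → ℝ) {α : ℝ} (hα : α < 1)
    (w : Fin 0 → X × Y × Z) : permTest B f α w = 0 := by
  have hN : ((cyclicLocalPerms B fun i => (w i).2.2).card : ℝ) ≠ 0 := by
    exact_mod_cast (card_cyclicLocalPerms_pos B _).ne'
  have : pValue B f (fun i => (w i).1) (fun i => (w i).2.1) (fun i => (w i).2.2) = 1 := by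
    rw [pValue, Finset.filter_true_of_mem, div_self hN]
    intro π _
    refine le_of_eq ?_
    congr 1
    exact Subsingleton.elim _ _
  rw [permTest, this, if_neg (not_le.2 hα)]

end Perms

/-! ### Measurability of the test -/

section Measurability

variable {X Y Z : Type*} [MeasurableSpace X] [MeasurableSpace Y] [MeasurableSpace Z] {M b n : ℕ}
  (B : DoubleBinning Z M b) {f : (Fin M → Σ s : ℕ, (Fin s → X × Y)) → ℝ}

theorem measurable_sigma_mk {ι : Type*} {β : ι → Type*} [∀ i, MeasurableSpace (β i)] (i : ι) :
    Measurable (Sigma.mk i : β i → Sigma β) :=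
  fun _ hS => iInf_le (fun i => (inferInstance : MeasurableSpace (β i)).map (Sigma.mk i)) i _ hS

theorem measurable_statistic (hf : Measurable f) (z : Fin n → Z) {Ω : Type*} [MeasurableSpace Ω]
    {x : Ω → Fin n → X} {y : Ω → Fin n → Y} (hx : Measurable x) (hy : Measurable y) :
    Measurable fun ω => statistic B f (x ω) (y ω) z := by
  refine hf.comp (measurable_pi_lambda _ fun m => ?_)
  refine (measurable_sigma_mk (β := fun s : ℕ => (Fin s → X × Y)) _).comp
    (measurable_pi_lambda _ fun j => ?_)
  exact ((measurable_pi_apply _).comp hx).prodMk ((measurable_pi_apply _).comp hy)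

open Classical in
theorem measurable_pValue (hf : Measurable f) (z : Fin n → Z) {Ω : Type*} [MeasurableSpace Ω]
    {x : Ω → Fin n → X} {y : Ω → Fin n → Y} (hx : Measurable x) (hy : Measurable y) :
    Measurable fun ω => pValue B f (x ω) (y ω) z := by
  simp only [pValue, Finset.card_filter, Nat.cast_sum]
  refine Measurable.div_const (Finset.measurable_sum _ fun π _ => ?_) _
  have : MeasurableSet {ω | statistic B f (x ω) (y ω) z ≤
      statistic B f (x ω) (fun i => y ω (π i)) z} :=
    measurableSet_le (measurable_statistic B hf z hx hy) (measurable_statistic B hf z hx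
      (measurable_pi_lambda _ fun i => (measurable_pi_apply _).comp hy))
  simp only [Nat.cast_ite]
  exact Measurable.ite this measurable_const measurable_const

/-- The index sets and the permutation set depend on `z`, but are constant once `z` is fixed;
countability allows arguing one `z` at a time. -/
theorem measurable_permTest [Countable Z] [MeasurableSingletonClass Z] (hf : Measurable f)
    (α : ℝ) : Measurable (permTest B f α (n := n)) := by
  classical
  have h : Measurable fun u : (Fin n → Z) × (Fin n → X × Y × Z) =>
      (if pValue B f (fun i => (u.2 i).1) (fun i => (u.2 i).2.1) u.1 ≤ α
        then 1 else 0 : ℝ≥0∞) := by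
    refine measurable_from_prod_countable_right fun z => ?_
    refine Measurable.ite (measurableSet_le (measurable_pValue B hf z ?_ ?_) measurable_const)
      measurable_const measurable_const <;> fun_prop
  have hg : Measurable fun w : Fin n → X × Y × Z => ((fun i => (w i).2.2), w) := by fun_prop
  convert h.comp hg using 1
  ext w
  simp only [permTest, Function.comp]

end Measurability

/-! ### Validity of the test under independence within the bins -/

section Validity

variable {X Y : Type*} [MeasurableSpace X] [MeasurableSpace Y] {M b n : ℕ}
  {f : (Fin M → Σ s : ℕ, (Fin s → X × Y)) → ℝ}

theorem measurePreserving_comp_perm {Ω : Type*} [MeasurableSpace Ω] (ρ : Measure Ω)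
    [SigmaFinite ρ] (σ : Equiv.Perm (Fin n)) :
    ∃ e : (Fin n → Ω) ≃ᵐ (Fin n → Ω), (∀ V i, e V i = V (σ i)) ∧
      MeasurePreserving e (Measure.pi fun _ => ρ) (Measure.pi fun _ => ρ) := by
  refine ⟨MeasurableEquiv.piCongrLeft (fun _ => Ω) σ.symm, fun V i => ?_,
    measurePreserving_piCongrLeft (fun _ : Fin n => ρ) σ.symm⟩
  have := Equiv.piCongrLeft_apply_apply (fun _ : Fin n => Ω) σ.symm V (σ i)
  rw [Equiv.symm_apply_apply] at this
  exact this

open Classical in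
/-- Validity of the test conditionally on the labels and on the `X`-values, when `Y_i` is drawn
from a distribution that depends only on the label of the `i`-th observation. -/
theorem lintegral_permTest_conditional_le (hf : Measurable f) {α : ℝ} (hα : 0 ≤ α)
    (ρ : Measure (Fin M × Fin b → Y)) [IsProbabilityMeasure ρ]
    (j : Fin n → Fin M × Fin b) (x : Fin n → X) :
    ∫⁻ V, permTest (labelBinning M b) f α (fun i => (x i, V i (j i), j i))
      ∂(Measure.pi fun _ : Fin n => ρ) ≤ ENNReal.ofReal α := by
  set B := labelBinning M b
  set G := cyclicLocalPerms B j with hG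
  set F : (Fin n → Fin M × Fin b → Y) → ℝ≥0∞ := fun V =>
    permTest B f α (fun i => (x i, V i (j i), j i)) with hF
  have mF : Measurable F := by
    refine (measurable_permTest B hf α).comp (measurable_pi_lambda _ fun i => ?_)
    fun_prop
  have hinv (σ : Equiv.Perm (Fin n)) :
      ∫⁻ V, F (fun i => V (σ i)) ∂(Measure.pi fun _ : Fin n => ρ) =
        ∫⁻ V, F V ∂(Measure.pi fun _ : Fin n => ρ) := by
    obtain ⟨e, he, hmp⟩ := measurePreserving_comp_perm ρ σ
    rw [← hmp.lintegral_comp_emb e.measurableEmbedding F]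
    refine lintegral_congr fun V => ?_
    congr 1
    exact (funext (he V)).symm
  have hpt (V : Fin n → Fin M × Fin b → Y) :
      ∑ σ ∈ G, F (fun i => V (σ i)) ≤ ENNReal.ofReal α * G.card := by
    have h1 : ∑ σ ∈ G, F (fun i => V (σ i)) = ((G.filter fun σ =>
        pValue B f x (fun i => (fun i => V i (j i)) (σ i)) j ≤ α).card : ℝ≥0∞) := by
      rw [Finset.card_filter, Nat.cast_sum]
      refine Finset.sum_congr rfl fun σ hσ => ?_
      -- Each observation carries a `Y`-value for every label, so the `V i` are identically
      -- distributed whatever the labels. As `σ` preserves labels, permuting `V` is the same as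
      -- permuting the observed `Y`-values.
      have hlab (i) : V (σ i) (j i) = V (σ i) (j (σ i)) := by
        rw [label_of_mem_cyclicLocalPerms hσ]
      simp only [hF, permTest, hlab, Nat.cast_ite, Nat.cast_one, Nat.cast_zero]
    rw [h1]
    have h2 := card_filter_pValue_le B f hα x (fun i => V i (j i)) j
    have h3 := ENNReal.ofReal_le_ofReal h2
    rwa [ENNReal.ofReal_mul hα, ENNReal.ofReal_natCast, ENNReal.ofReal_natCast] at h3
  have hN0 : (G.card : ℝ≥0∞) ≠ 0 := by
    exact_mod_cast (card_cyclicLocalPerms_pos B j).ne'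
  have hsum : (G.card : ℝ≥0∞) * ∫⁻ V, F V ∂(Measure.pi fun _ : Fin n => ρ) ≤
      G.card * ENNReal.ofReal α := by
    calc (G.card : ℝ≥0∞) * ∫⁻ V, F V ∂(Measure.pi fun _ : Fin n => ρ) =
          ∑ σ ∈ G, ∫⁻ V, F (fun i => V (σ i)) ∂(Measure.pi fun _ : Fin n => ρ) := by
          simp only [hinv, Finset.sum_const, nsmul_eq_mul]
      _ = ∫⁻ V, ∑ σ ∈ G, F (fun i => V (σ i)) ∂(Measure.pi fun _ : Fin n => ρ) := by
          rw [lintegral_finsetSum]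
          exact fun σ _ => mF.comp (measurable_pi_lambda _ fun i => measurable_pi_apply _)
      _ ≤ ∫⁻ _, ENNReal.ofReal α * G.card ∂(Measure.pi fun _ : Fin n => ρ) :=
          lintegral_mono hpt
      _ = G.card * ENNReal.ofReal α := by
          rw [lintegral_const, measure_univ, mul_one, mul_comm]
  exact (ENNReal.mul_le_mul_iff_right hN0 (ENNReal.natCast_ne_top _)).1 hsum

/-- Picks the coordinates indexed by a random label. -/
def pickLabel {J X Y : Type*} (u : J × (J → X) × (J → Y)) : X × Y × J :=
  (u.2.1 u.1, u.2.2 u.1, u.1)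

theorem measurable_pickLabel {J X Y : Type*} [MeasurableSpace J] [MeasurableSpace X]
    [MeasurableSpace Y] [Countable J] [MeasurableSingletonClass J] :
    Measurable (pickLabel : J × (J → X) × (J → Y) → X × Y × J) := by
  refine measurable_from_prod_countable_right fun j => ?_
  exact ((measurable_pi_apply j).comp measurable_fst).prodMk
    (((measurable_pi_apply j).comp measurable_snd).prodMk measurable_const)

/-- The law of `(X_J, Y_J, J)` for independent `J`, `(X_j)`, `(Y_j)`: given the label, the first
two components are independent with conditional laws `a j` and `c j`. -/
def blockLaw {J : Type*} [Fintype J] [MeasurableSpace J] (p : Measure J) (a : J → Measure X)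
    (c : J → Measure Y) : Measure (X × Y × J) :=
  (p.prod ((Measure.pi a).prod (Measure.pi c))).map pickLabel

section BlockLaw

variable {J : Type*} [Fintype J] [MeasurableSpace J] [MeasurableSingletonClass J]
  (p : Measure J) (a : J → Measure X) (c : J → Measure Y) [IsProbabilityMeasure p]
  [∀ j, IsProbabilityMeasure (a j)] [∀ j, IsProbabilityMeasure (c j)]

instance : IsProbabilityMeasure (blockLaw p a c) :=
  Measure.isProbabilityMeasure_map measurable_pickLabel.aemeasurable

omit [IsProbabilityMeasure p] in
theorem blockLaw_apply [SFinite p] {S : Set X} {T : Set Y} (hS : MeasurableSet S) (hT : MeasurableSet T)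
    (j : J) : blockLaw p a c (S ×ˢ T ×ˢ {j}) = p {j} * (a j S * c j T) := by
  rw [blockLaw, Measure.map_apply measurable_pickLabel
    (hS.prod (hT.prod (measurableSet_singleton j)))]
  have : pickLabel ⁻¹' (S ×ˢ T ×ˢ {j}) =
      {j} ×ˢ ((Function.eval j ⁻¹' S) ×ˢ (Function.eval j ⁻¹' T) : Set ((J → X) × (J → Y))) := by
    ext ⟨i, x, y⟩
    simp only [pickLabel, Set.mem_preimage, Set.mem_prod, Set.mem_singleton_iff, Function.eval]
    constructor
    · rintro ⟨h1, h2, rfl⟩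
      exact ⟨rfl, h1, h2⟩
    · rintro ⟨rfl, h1, h2⟩
      exact ⟨h1, h2, rfl⟩
  rw [this, Measure.prod_prod, Measure.prod_prod,
    (measurePreserving_eval a j).measure_preimage hS.nullMeasurableSet,
    (measurePreserving_eval c j).measure_preimage hT.nullMeasurableSet]

end BlockLaw

/-- Only an inequality is claimed, so `K` needs no measurability. -/
theorem lintegral_pi_prod_le {Ω Ω' : Type*} [MeasurableSpace Ω] [MeasurableSpace Ω']
    (μ : Measure Ω) (ν : Measure Ω') [SigmaFinite μ] [SigmaFinite ν]
    (K : (Fin n → Ω) × (Fin n → Ω') → ℝ≥0∞) :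
    ∫⁻ u, K (fun i => (u i).1, fun i => (u i).2) ∂(Measure.pi fun _ : Fin n => μ.prod ν) ≤
      ∫⁻ x, ∫⁻ y, K (x, y) ∂(Measure.pi fun _ : Fin n => ν) ∂(Measure.pi fun _ : Fin n => μ) := by
  refine le_trans (le_of_eq ?_) (lintegral_prod_le K)
  exact (measurePreserving_arrowProdEquivProdArrow Ω Ω' (Fin n) (fun _ => μ)
    (fun _ => ν)).lintegral_comp_emb (MeasurableEquiv.measurableEmbedding _) K

/-- The test has level `α` if the two components are independent given the label. -/
theorem lintegral_permTest_blockLaw_le (hf : Measurable f) {α : ℝ} (hα : 0 ≤ α)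
    (p : Measure (Fin M × Fin b)) (a : Fin M × Fin b → Measure X)
    (c : Fin M × Fin b → Measure Y) [IsProbabilityMeasure p]
    [∀ j, IsProbabilityMeasure (a j)] [∀ j, IsProbabilityMeasure (c j)] :
    ∫⁻ w, permTest (labelBinning M b) f α w ∂(Measure.pi fun _ : Fin n => blockLaw p a c) ≤
      ENNReal.ofReal α := by
  have hmap : (Measure.pi fun _ : Fin n => blockLaw p a c) =
      (Measure.pi fun _ : Fin n => p.prod ((Measure.pi a).prod (Measure.pi c))).map
        (fun u i => pickLabel (u i)) := by
    have (i : Fin n) : SigmaFinite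
        ((p.prod ((Measure.pi a).prod (Measure.pi c))).map pickLabel) :=
      inferInstanceAs (SigmaFinite (blockLaw p a c))
    exact (Measure.pi_map_pi fun _ => measurable_pickLabel.aemeasurable).symm
  have hpick : Measurable fun (u : Fin n → (Fin M × Fin b) × (Fin M × Fin b → X) ×
      (Fin M × Fin b → Y)) i => pickLabel (u i) :=
    measurable_pi_lambda _ fun i => measurable_pickLabel.comp (measurable_pi_apply i)
  rw [hmap, lintegral_map (measurable_permTest _ hf α) hpick]
  set K : (Fin n → Fin M × Fin b) × (Fin n → (Fin M × Fin b → X) × (Fin M × Fin b → Y)) →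
    ℝ≥0∞ := fun v => permTest (labelBinning M b) f α fun i => pickLabel (v.1 i, v.2 i) with hK
  set K' : (Fin n → Fin M × Fin b) → (Fin n → Fin M × Fin b → X) × (Fin n → Fin M × Fin b → Y) →
    ℝ≥0∞ := fun j v => permTest (labelBinning M b) f α
      fun i => (v.1 i (j i), v.2 i (j i), j i) with hK'
  have hinner (j : Fin n → Fin M × Fin b) :
      ∫⁻ v, K (j, v) ∂(Measure.pi fun _ : Fin n => (Measure.pi a).prod (Measure.pi c)) ≤
        ENNReal.ofReal α :=
    calc _ ≤ ∫⁻ x, ∫⁻ y, K' j (x, y) ∂(Measure.pi fun _ : Fin n => Measure.pi c)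
          ∂(Measure.pi fun _ : Fin n => Measure.pi a) :=
          lintegral_pi_prod_le (Measure.pi a) (Measure.pi c) (K' j)
      _ ≤ ∫⁻ _, ENNReal.ofReal α ∂(Measure.pi fun _ : Fin n => Measure.pi a) :=
          lintegral_mono fun x =>
            lintegral_permTest_conditional_le hf hα (Measure.pi c) j fun i => x i (j i)
      _ = ENNReal.ofReal α := by rw [lintegral_const, measure_univ, mul_one]
  calc _ ≤ ∫⁻ j, ∫⁻ v, K (j, v)
        ∂(Measure.pi fun _ : Fin n => (Measure.pi a).prod (Measure.pi c))
        ∂(Measure.pi fun _ : Fin n => p) := lintegral_pi_prod_le p _ K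
    _ ≤ ∫⁻ _, ENNReal.ofReal α ∂(Measure.pi fun _ : Fin n => p) := lintegral_mono hinner
    _ = ENNReal.ofReal α := by rw [lintegral_const, measure_univ, mul_one]

end Validity

/-! ### Comparison of the law of the binned data with a law of level `α` -/

/-- `lam` is the conditional law on `S`, or the default `ν` if `S` is null, so that a probability
measure is available for every bin. -/
theorem exists_restrict_eq_smul {Z : Type*} [MeasurableSpace Z] (ν : Measure Z)
    [IsProbabilityMeasure ν] {S : Set Z} (hS : MeasurableSet S) :
    ∃ lam : Measure Z, IsProbabilityMeasure lam ∧ ν.restrict S = ν S • lam ∧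
      (ν S ≠ 0 → ∀ᵐ z ∂lam, z ∈ S) := by
  by_cases h : ν S = 0
  · exact ⟨ν, inferInstance, by rw [h, zero_smul, Measure.restrict_eq_zero.2 h],
      fun h' => absurd h h'⟩
  · refine ⟨cond ν S, cond_isProbabilityMeasure h, ?_, fun _ => ae_cond_mem hS⟩
    rw [ProbabilityTheory.cond, smul_smul, ENNReal.mul_inv_cancel h (measure_ne_top _ _), one_smul]

theorem HellingerSqLE.sum_le {Ω : Type*} [MeasurableSpace Ω] {P Q : Measure Ω} {e : ℝ}
    (he : 0 ≤ e) (h : HellingerSqLE P Q (ENNReal.ofReal e)) {A : Type} [Fintype A] {s : Ω → A}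
    (hs : ∀ a, MeasurableSet (s ⁻¹' {a})) :
    ∑ a, (√(P.real (s ⁻¹' {a})) - √(Q.real (s ⁻¹' {a}))) ^ 2 ≤ e :=
  (ENNReal.ofReal_le_ofReal_iff he).1 (h A s hs)

section Comparison

variable {X : Type u} {Y : Type v} {Z : Type w} [MeasurableSpace X] [MeasurableSpace Y]
  [MeasurableSpace Z] {M b n : ℕ} (B : DoubleBinning Z M b)

/-- The law of an observation in which the third component is replaced by its bin label. -/
def labelLaw (P : Measure (X × Y × Z)) : Measure (X × Y × (Fin M × Fin b)) :=
  P.map fun w => (w.1, w.2.1, B.label w.2.2)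

theorem measurable_labelMap :
    Measurable fun w : X × Y × Z => (w.1, w.2.1, B.label w.2.2) := by
  have := B.measurable_label
  fun_prop

instance (P : Measure (X × Y × Z)) [IsProbabilityMeasure P] :
    IsProbabilityMeasure (labelLaw B P) :=
  Measure.isProbabilityMeasure_map (measurable_labelMap B).aemeasurable

theorem labelLaw_apply {P : Measure (X × Y × Z)} [IsProbabilityMeasure P] {κX : Kernel Z X}
    {κY : Kernel Z Y} (h : IsCondIndepVersion P κX κY) {S : Set X} {T : Set Y}
    (hS : MeasurableSet S) (hT : MeasurableSet T) (j : Fin M × Fin b) :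
    labelLaw B P (S ×ˢ T ×ˢ {j}) =
      ∫⁻ z in B.label ⁻¹' {j}, κX z S * κY z T ∂(P.map fun w => w.2.2) := by
  obtain ⟨h1, h2, h3⟩ := h
  have hν : IsProbabilityMeasure (P.map fun w : X × Y × Z => w.2.2) :=
    Measure.isProbabilityMeasure_map (by fun_prop)
  have hj : MeasurableSet (B.label ⁻¹' {j}) := B.measurable_label (measurableSet_singleton j)
  have e1 : labelLaw B P (S ×ˢ T ×ˢ {j}) =
      P.map (fun w => (w.2.2, (w.1, w.2.1))) ((B.label ⁻¹' {j}) ×ˢ (S ×ˢ T)) := by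
    rw [labelLaw, Measure.map_apply (measurable_labelMap B)
      (hS.prod (hT.prod (measurableSet_singleton j))), Measure.map_apply (by fun_prop)
      (hj.prod (hS.prod hT))]
    congr 1
    ext w
    simp only [Set.mem_preimage, Set.mem_prod]
    tauto
  rw [e1, h3, Measure.compProd_apply_prod hj (hS.prod hT)]
  refine lintegral_congr fun z => ?_
  rw [Kernel.prod_apply, Measure.prod_prod]

/-- Take for `p` the law of the label, and for `a j`, `c j` the mixtures of `κX`, `κY` over the
conditional law of `Z` in bin `j`. Both laws give the same weight to each label, so the sum is an
average over bins of the mixture-versus-product bound. -/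
theorem sum_labelLaw_blockLaw_le {P : Measure (X × Y × Z)} [IsProbabilityMeasure P]
    {κX : Kernel Z X} {κY : Kernel Z Y} (h : IsCondIndepVersion P κX κY) {e : ℝ} (he : 0 ≤ e)
    (hX : ∀ m k, ∀ z ∈ B.fine m k, ∀ z' ∈ B.fine m k,
      HellingerSqLE (κX z) (κX z') (ENNReal.ofReal e))
    (hY : ∀ m k, ∀ z ∈ B.fine m k, ∀ z' ∈ B.fine m k,
      HellingerSqLE (κY z) (κY z') (ENNReal.ofReal e)) :
    ∃ (p : Measure (Fin M × Fin b)) (a : Fin M × Fin b → Measure X)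
      (c : Fin M × Fin b → Measure Y) (_ : IsProbabilityMeasure p)
      (_ : ∀ j, IsProbabilityMeasure (a j)) (_ : ∀ j, IsProbabilityMeasure (c j)),
      ∀ (A A' : Type) [Fintype A] [Fintype A'] (s : X → A) (t : Y → A'),
        (∀ a, MeasurableSet (s ⁻¹' {a})) → (∀ a, MeasurableSet (t ⁻¹' {a})) →
        ∑ i : A × A' × (Fin M × Fin b),
          (√((labelLaw B P).real ((fun w => (s w.1, t w.2.1, w.2.2)) ⁻¹' {i})) -
            √((blockLaw p a c).real ((fun w => (s w.1, t w.2.1, w.2.2)) ⁻¹' {i}))) ^ 2 ≤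
          2 * e ^ 2 := by
  have hκX := h.1
  have hκY := h.2.1
  set ν := P.map fun w => w.2.2 with hν
  have hν1 : IsProbabilityMeasure ν := Measure.isProbabilityMeasure_map (by fun_prop)
  have hlab (j) : MeasurableSet (B.label ⁻¹' {j}) :=
    B.measurable_label (measurableSet_singleton j)
  choose lam hlam1 hlam2 hlam3 using fun j => exists_restrict_eq_smul ν (hlab j)
  have hp : IsProbabilityMeasure (ν.map B.label) :=
    Measure.isProbabilityMeasure_map B.measurable_label.aemeasurable
  refine ⟨ν.map B.label, fun j => (lam j).bind κX, fun j => (lam j).bind κY, hp,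
    fun j => inferInstance, fun j => inferInstance, fun A A' _ _ s t hs ht => ?_⟩
  have hcell (i : A × A' × (Fin M × Fin b)) :
      (fun w : X × Y × (Fin M × Fin b) => (s w.1, t w.2.1, w.2.2)) ⁻¹' {i} =
        (s ⁻¹' {i.1}) ×ˢ (t ⁻¹' {i.2.1}) ×ˢ {i.2.2} := by
    ext; simp [Prod.ext_iff]
  have mX (i : A) : Measurable fun z => (κX z).real (s ⁻¹' {i}) :=
    (κX.measurable_coe (hs i)).ennreal_toReal
  have mY (i : A') : Measurable fun z => (κY z).real (t ⁻¹' {i}) :=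
    (κY.measurable_coe (ht i)).ennreal_toReal
  have bindX (i : A) (j) : ((lam j).bind κX).real (s ⁻¹' {i}) =
      ∫ z, (κX z).real (s ⁻¹' {i}) ∂(lam j) := by
    rw [measureReal_def, Measure.bind_apply (hs i) κX.aemeasurable]
    exact (integral_toReal (κX.measurable_coe (hs i)).aemeasurable
      (.of_forall fun z => measure_lt_top _ _)).symm
  have bindY (i : A') (j) : ((lam j).bind κY).real (t ⁻¹' {i}) =
      ∫ z, (κY z).real (t ⁻¹' {i}) ∂(lam j) := by
    rw [measureReal_def, Measure.bind_apply (ht i) κY.aemeasurable]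
    exact (integral_toReal (κY.measurable_coe (ht i)).aemeasurable
      (.of_forall fun z => measure_lt_top _ _)).symm
  have hR (i : A × A' × (Fin M × Fin b)) : (blockLaw (ν.map B.label) (fun j => (lam j).bind κX)
      (fun j => (lam j).bind κY)).real ((s ⁻¹' {i.1}) ×ˢ (t ⁻¹' {i.2.1}) ×ˢ {i.2.2}) =
      ν.real (B.label ⁻¹' {i.2.2}) * ((∫ z, (κX z).real (s ⁻¹' {i.1}) ∂(lam i.2.2)) *
        ∫ z, (κY z).real (t ⁻¹' {i.2.1}) ∂(lam i.2.2)) := by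
    rw [measureReal_def, blockLaw_apply _ _ _ (hs _) (ht _), ENNReal.toReal_mul,
      ENNReal.toReal_mul, Measure.map_apply B.measurable_label (measurableSet_singleton _),
      ← bindX, ← bindY]
    rfl
  have hQ (i : A × A' × (Fin M × Fin b)) :
      (labelLaw B P).real ((s ⁻¹' {i.1}) ×ˢ (t ⁻¹' {i.2.1}) ×ˢ {i.2.2}) =
      ν.real (B.label ⁻¹' {i.2.2}) *
        ∫ z, (κX z).real (s ⁻¹' {i.1}) * (κY z).real (t ⁻¹' {i.2.1}) ∂(lam i.2.2) := by
    rw [measureReal_def, labelLaw_apply B h (hs _) (ht _), hlam2, lintegral_smul_measure,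
      smul_eq_mul, ENNReal.toReal_mul]
    congr 1
    rw [← integral_toReal]
    · simp only [ENNReal.toReal_mul, measureReal_def]
    · exact ((κX.measurable_coe (hs _)).mul (κY.measurable_coe (ht _))).aemeasurable
    · exact .of_forall fun z => ENNReal.mul_lt_top (measure_lt_top _ _) (measure_lt_top _ _)
  have hsq (r x y : ℝ) (hr : 0 ≤ r) : (√(r * x) - √(r * y)) ^ 2 = r * (√x - √y) ^ 2 := by
    rw [Real.sqrt_mul hr, Real.sqrt_mul hr, ← mul_sub, mul_pow, Real.sq_sqrt hr]
  simp only [hcell, hR, hQ]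
  simp only [hsq _ _ _ measureReal_nonneg, Fintype.sum_prod_type_right (γ := ℝ) (α₁ := A)]
  have hconv (F : A' × (Fin M × Fin b) → A → ℝ) :
      ∑ y, ∑ x, F y x = ∑ j, ∑ i, ∑ i', F (i', j) i := by
    rw [Fintype.sum_prod_type_right]
    exact Finset.sum_congr rfl fun j _ => Finset.sum_comm
  rw [hconv]
  simp only [← Finset.mul_sum]
  calc _ ≤ ∑ j, ν.real (B.label ⁻¹' {j}) * (2 * e ^ 2) := by
        refine Finset.sum_le_sum fun j _ => ?_
        -- On a null bin `lam j` need not live in the bin, but the weight is zero.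
        by_cases h0 : ν (B.label ⁻¹' {j}) = 0
        · simp [measureReal_def, h0]
        · refine mul_le_mul_of_nonneg_left ?_ measureReal_nonneg
          have hfine := B.fine_eq_preimage j.1 j.2
          exact hellinger_mixture_le (lam j) (S := B.fine j.1 j.2) mX mY
            (fun _ _ => measureReal_nonneg) (fun _ _ => measureReal_nonneg)
            (fun _ _ => measureReal_le_one) (fun _ _ => measureReal_le_one)
            (by rw [hfine]; exact hlam3 j h0)
            (fun z hz z' hz' => (hX _ _ z hz z' hz').sum_le he hs)
            (fun z hz z' hz' => (hY _ _ z hz z' hz').sum_le he ht)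
    _ = 2 * e ^ 2 := by
        rw [← Finset.sum_mul, sum_preimage_eq_one ν hlab, one_mul]

/-- The type I error of the test is at most `α + 3 √n e` if the conditional laws within each fine
bin are within `e` in squared Hellinger distance. -/
theorem lintegral_permTest_le {f : (Fin M → Σ s : ℕ, (Fin s → X × Y)) → ℝ} (hf : Measurable f)
    {α : ℝ} (hα0 : 0 ≤ α) (hα1 : α < 1) {P : Measure (X × Y × Z)} [IsProbabilityMeasure P]
    {κX : Kernel Z X} {κY : Kernel Z Y} (h : IsCondIndepVersion P κX κY) {e : ℝ≥0∞}
    (hX : ∀ m k, ∀ z ∈ B.fine m k, ∀ z' ∈ B.fine m k, HellingerSqLE (κX z) (κX z') e)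
    (hY : ∀ m k, ∀ z ∈ B.fine m k, ∀ z' ∈ B.fine m k, HellingerSqLE (κY z) (κY z') e) :
    ∫⁻ w, permTest B f α w ∂(Measure.pi fun _ : Fin n => P) ≤
      ENNReal.ofReal α + 3 * (n : ℝ≥0∞) ^ (1 / 2 : ℝ) * e := by
  rcases n.eq_zero_or_pos with rfl | hn
  · simp [permTest_eq_zero B f hα1]
  rcases eq_or_ne e ⊤ with rfl | het
  · rw [ENNReal.mul_top, add_top]
    · exact le_top
    · simp [ENNReal.rpow_eq_zero_iff, hn.ne']
  obtain ⟨p, a, c, hp, ha, hc, hsum⟩ := sum_labelLaw_blockLaw_le B h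
    (ENNReal.toReal_nonneg (a := e)) (by rwa [ENNReal.ofReal_toReal het])
    (by rwa [ENNReal.ofReal_toReal het])
  have mT := measurable_permTest (n := n) (labelBinning M b) hf α
  set E : Set (Fin n → X × Y × (Fin M × Fin b)) :=
    {w | permTest (labelBinning M b) f α w = 1} with hE
  have mE : MeasurableSet E := mT (measurableSet_singleton 1)
  have hind : permTest (n := n) (labelBinning M b) f α = E.indicator 1 := by
    ext w
    by_cases hw : w ∈ E
    · rw [Set.indicator_of_mem hw]; exact hw
    · rw [Set.indicator_of_notMem hw]
      by_contra h0
      refine hw ?_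
      simp only [hE, Set.mem_ofPred_eq, permTest] at h0 ⊢
      split_ifs at h0 ⊢ <;> simp_all
  have hmap : (Measure.pi fun _ : Fin n => labelLaw B P) =
      (Measure.pi fun _ : Fin n => P).map
        fun w i => ((w i).1, (w i).2.1, B.label (w i).2.2) := by
    have (i : Fin n) : SigmaFinite (P.map fun w => (w.1, w.2.1, B.label w.2.2)) :=
      inferInstanceAs (SigmaFinite (labelLaw B P))
    exact (Measure.pi_map_pi fun _ => (measurable_labelMap B).aemeasurable).symm
  have hmeas : Measurable fun (w : Fin n → X × Y × Z) i =>
      ((w i).1, (w i).2.1, B.label (w i).2.2) :=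
    measurable_pi_lambda _ fun i => (measurable_labelMap B).comp (measurable_pi_apply i)
  have e1 : ∫⁻ w, permTest B f α w ∂(Measure.pi fun _ : Fin n => P) =
      (Measure.pi fun _ : Fin n => labelLaw B P) E := by
    rw [← lintegral_indicator_one mE, ← hind, hmap, lintegral_map mT hmeas]
    exact lintegral_congr fun w => permTest_label B f α w
  have e2 : (Measure.pi fun _ : Fin n => blockLaw p a c).real E ≤ α := by
    have := lintegral_permTest_blockLaw_le (n := n) hf hα0 p a c
    rw [hind, lintegral_indicator_one mE] at this
    exact ENNReal.toReal_le_of_le_ofReal hα0 this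
  have e3 := pi_le_of_discrete (n := n) (labelLaw B P) (blockLaw p a c) hsum mE
  rw [e1, ← ofReal_measureReal]
  have hfinal : (Measure.pi fun _ : Fin n => labelLaw B P).real E ≤ α + 3 * √n * e.toReal := by
    refine e3.trans (add_le_add e2 ?_)
    rw [Real.sqrt_mul (by positivity), Real.sqrt_mul (by norm_num),
      Real.sqrt_sq ENNReal.toReal_nonneg]
    -- The constant `3` rounds up `2 √2`: a factor `2` from tensorization and `√2` from `2 e²`.
    have h2 : 2 * √(2 : ℝ) ≤ 3 := by
      have : √(2 : ℝ) ≤ 3 / 2 := Real.sqrt_le_iff.2 ⟨by norm_num, by norm_num⟩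
      linarith
    calc 2 * (√(n : ℝ) * (√2 * e.toReal)) = (2 * √2) * (√n * e.toReal) := by ring
      _ ≤ 3 * (√n * e.toReal) := by gcongr
      _ = _ := by ring
  refine (ENNReal.ofReal_le_ofReal hfinal).trans (le_of_eq ?_)
  rw [ENNReal.ofReal_add hα0 (by positivity), ENNReal.ofReal_mul (by positivity),
    ENNReal.ofReal_mul (by norm_num), ENNReal.ofReal_toReal het, Real.sqrt_eq_rpow,
    ← ENNReal.ofReal_rpow_of_nonneg (by positivity) (by norm_num), ENNReal.ofReal_natCast]
  simp

theorem edist_le_maxDiam [MetricSpace Z] {m : Fin M} {k : Fin b} {z z' : Z}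
    (hz : z ∈ B.fine m k) (hz' : z' ∈ B.fine m k) : edist z z' ≤ B.maxDiam :=
  le_iSup₂_of_le m k (le_iSup₂_of_le z hz (le_iSup₂_of_le z' hz' le_rfl))

end Comparison

theorem HellingerSqLE.mono {Ω : Type*} [MeasurableSpace Ω] {P Q : Measure Ω} {e e' : ℝ≥0∞}
    (h : HellingerSqLE P Q e) (hee' : e ≤ e') : HellingerSqLE P Q e' :=
  fun A _ s hs => (h A s hs).trans hee'

/-- The type I error under a Lipschitz condition that controls the squared Hellinger distance. -/
theorem iSup_lintegral_permTest_le {X : Type u} {Y : Type v} {Z : Type w} [MeasurableSpace X]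
    [MeasurableSpace Y] [MeasurableSpace Z] [MetricSpace Z] {M b n : ℕ} (B : DoubleBinning Z M b)
    {f : (Fin M → Σ s : ℕ, (Fin s → X × Y)) → ℝ} (hf : Measurable f) {L : ℝ≥0} {α : ℝ}
    (hα0 : 0 < α) (hα1 : α < 1) {C : ℝ≥0} {r : ℝ} (hr : 0 ≤ r)
    {𝓟 : Set (ProbabilityMeasure (X × Y × Z))}
    (h𝓟 : ∀ P ∈ 𝓟, ∃ (κX : Kernel Z X) (κY : Kernel Z Y),
      IsCondIndepVersion (P : Measure (X × Y × Z)) κX κY ∧ ∀ z z',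
        HellingerSqLE (κX z) (κX z') (C * (L * edist z z') ^ r) ∧
        HellingerSqLE (κY z) (κY z') (C * (L * edist z z') ^ r)) :
    ⨆ P ∈ 𝓟, ∫⁻ w, permTest B f α w ∂(Measure.pi fun _ : Fin n => (P : Measure (X × Y × Z))) ≤
      ENNReal.ofReal α + ↑(3 * C) * (n : ℝ≥0∞) ^ (1 / 2 : ℝ) * (L : ℝ≥0∞) ^ r *
        B.maxDiam ^ r := by
  refine iSup₂_le fun P hP => ?_
  obtain ⟨κX, κY, hind, hκ⟩ := h𝓟 P hP
  have hle {m k z z'} (hz : z ∈ B.fine m k) (hz' : z' ∈ B.fine m k) :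
      C * ((L : ℝ≥0∞) * edist z z') ^ r ≤ C * (L * B.maxDiam) ^ r := by
    gcongr
    exact edist_le_maxDiam B hz hz'
  refine (lintegral_permTest_le B hf hα0.le hα1 hind (e := C * (L * B.maxDiam) ^ r)
    (fun m k z hz z' hz' => (hκ z z').1.mono (hle hz hz'))
    (fun m k z hz z' hz' => (hκ z z').2.mono (hle hz hz'))).trans (le_of_eq ?_)
  -- For a nonnegative exponent this splitting also holds with infinite diameter and `0 · ∞ = 0`.
  rw [ENNReal.mul_rpow_of_nonneg _ _ hr, ENNReal.coe_mul, ENNReal.coe_ofNat]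
  congr 1
  ring

end DoubleBinTest

end

/-! ### Assembly of the bounds. -/

theorem mainTheorem9 :
    -- bounds under Hellinger Lipschitzness
    (∀ γ : ℝ, 1 ≤ γ → ∃ C : ℝ≥0,
      ∀ (X : Type u) (Y : Type v) (Z : Type w) [MeasurableSpace X] [MeasurableSpace Y]
        [MeasurableSpace Z] [MetricSpace Z] (M b n : ℕ) (B : DoubleBinTest.DoubleBinning Z M b)
        (f : (Fin M → Σ s : ℕ, (Fin s → X × Y)) → ℝ) (_ : Measurable f)
        (L : ℝ≥0) (α : ℝ) (_ : 0 < α) (_ : α < 1),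
        ⨆ P ∈ DoubleBinTest.hellingerLipschitz (X := X) (Y := Y) (Z := Z) γ L,
            ∫⁻ w, DoubleBinTest.permTest B f α w
              ∂(Measure.pi fun _ : Fin n => (P : Measure (X × Y × Z)))
          ≤ if γ ≤ 2
            then ENNReal.ofReal α + C * (n : ℝ≥0∞) ^ (1 / 2 : ℝ) * (L : ℝ≥0∞) ^ γ * B.maxDiam ^ γ
            else ENNReal.ofReal α + C * (n : ℝ≥0∞) ^ (1 / 2 : ℝ) * (L : ℝ≥0∞) ^ 2 * B.maxDiam ^ 2)
    ∧
    -- bound under Renyi Lipschitzness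
    (∀ γ : ℝ, 0 < γ → ∃ C : ℝ≥0,
      ∀ (X : Type u) (Y : Type v) (Z : Type w) [MeasurableSpace X] [MeasurableSpace Y]
        [MeasurableSpace Z] [MetricSpace Z] (M b n : ℕ) (B : DoubleBinTest.DoubleBinning Z M b)
        (f : (Fin M → Σ s : ℕ, (Fin s → X × Y)) → ℝ) (_ : Measurable f)
        (L : ℝ≥0) (α : ℝ) (_ : 0 < α) (_ : α < 1),
        ⨆ P ∈ DoubleBinTest.renyiLipschitz (X := X) (Y := Y) (Z := Z) γ L,
            ∫⁻ w, DoubleBinTest.permTest B f α w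
              ∂(Measure.pi fun _ : Fin n => (P : Measure (X × Y × Z)))
          ≤ ENNReal.ofReal α + C * (n : ℝ≥0∞) ^ (1 / 2 : ℝ) * (L : ℝ≥0∞) ^ 2 * B.maxDiam ^ 2) := by
  open DoubleBinTest in
  refine ⟨fun γ hγ => ?_, fun γ hγ => ?_⟩
  · rcases le_or_gt γ 2 with h2 | h2
    -- The `2` comes from `hellingerSq ≤ 2 D^γ`; the exponent of `L h` is `γ`.
    · refine ⟨3 * 2, fun X Y Z _ _ _ _ M b n B f hf L α hα0 hα1 => ?_⟩
      rw [if_pos h2]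
      refine iSup_lintegral_permTest_le B hf hα0 hα1 (by linarith) ?_
      rintro P ⟨κX, κY, hind, hκ⟩
      have := hind.1
      have := hind.2.1
      refine ⟨κX, κY, hind, fun z z' => ⟨.of_le ?_, .of_le ?_⟩⟩ <;>
        refine (hellingerSq_le_of_le_two _ _ hγ h2).trans ?_ <;> rw [ENNReal.coe_ofNat] <;> gcongr
      exacts [(hκ z z').1, (hκ z z').2]
    · refine ⟨3 * (γ ^ 2 / 2).toNNReal, fun X Y Z _ _ _ _ M b n B f hf L α hα0 hα1 => ?_⟩
      rw [if_neg (not_le.2 h2), ← ENNReal.rpow_two, ← ENNReal.rpow_two]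
      refine iSup_lintegral_permTest_le B hf hα0 hα1 (by norm_num) ?_
      rintro P ⟨κX, κY, hind, hκ⟩
      have := hind.1
      have := hind.2.1
      refine ⟨κX, κY, hind, fun z z' => ⟨.of_le ?_, .of_le ?_⟩⟩ <;>
        refine (hellingerSq_le_of_two_lt _ _ h2).trans ?_ <;> rw [ENNReal.rpow_two] <;>
        refine mul_le_mul_right (pow_le_pow_left₀ zero_le ?_ 2) _
      exacts [(hκ z z').1, (hκ z z').2]
  -- The constant is obtained once per universe, for `X` and for `Y`; the maximum serves both.
  · obtain ⟨C₁, hC₁⟩ := exists_hellingerSqLE_renyiDiv.{u} hγ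
    obtain ⟨C₂, hC₂⟩ := exists_hellingerSqLE_renyiDiv.{v} hγ
    refine ⟨3 * max C₁ C₂, fun X Y Z _ _ _ _ M b n B f hf L α hα0 hα1 => ?_⟩
    rw [← ENNReal.rpow_two, ← ENNReal.rpow_two]
    refine iSup_lintegral_permTest_le B hf hα0 hα1 (by norm_num) ?_
    rintro P ⟨κX, κY, hind, hκ⟩
    have := hind.1
    have := hind.2.1
    have hpow {x y : ℝ≥0∞} (h : x ^ (1 / 2 : ℝ) ≤ y) : x ≤ y ^ (2 : ℝ) := by
      have := ENNReal.rpow_le_rpow h (by norm_num : (0 : ℝ) ≤ 2)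
      rwa [← ENNReal.rpow_mul, one_div_mul_cancel (by norm_num), ENNReal.rpow_one] at this
    refine ⟨κX, κY, hind, fun z z' => ⟨(hC₁ (κX z) (κX z')).mono ?_,
      (hC₂ (κY z) (κY z')).mono ?_⟩⟩
    · exact mul_le_mul' (by exact_mod_cast le_max_left _ _) (hpow (hκ z z').1)
    · exact mul_le_mul' (by exact_mod_cast le_max_right _ _) (hpow (hκ z z').2)
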